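/- **Setting.** Let $N\ge 2$ and let $K,H,A,I,J$ be positive integers with $A\le I$, $I+2A<J\le H$; put $L=J-I-2A$. Let $\mathbb F_q$ be a finite field. The files $W_1,\dots,W_N$ are independent and uniform on $\mathbb F_q^B$. There are $H$ servers and $K$ users. A *scheme* with file length $B\geq 1$ consists of: a discrete random variable $U$; random variables $P_1,\dots,P_K$ with values in a finite set; server contents $Z_h=\chi_h(W_{[N]},U)\in\mathbb F_q^{z}$, $h\in[H]$; user caches $C_k=\varphi_k(P_k,U,W_{[N]})\in\mathbb F_q^{c}$, $k\in[K]$; queries $Q_{k,h}=\kappa_{k,h}(\mathbf d_k,P_k)$, which are words over $\mathbb F_q$, where $\mathbf d_k\in\mathbb F_q^N$ is the demand of user $k$; and signals $X_h=\phi_h(Z_h,Q_{[K],h})\in\mathbb F_q^{x_h}$. The variables $W_{[N]},U,P_1,\dots,P_K,\mathbf d_1,\dots,\mathbf d_K$ are independent. Memory size, storage size and communication load are $c/B$, $z/B$ and $\max_h x_h/B$. User $k$ wants $W_{\mathbf d_k}=\sum_n d_{k,n}W_n$. For $\mathcal A\subseteq[H]$, *falsified contents* of $\mathcal A$ are random $\widetilde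 Z_h\in\mathbb F_q^z$, $h\in\mathcal A$, with $I(W_{[N]},Z_{[H]\setminus\mathcal A};\widetilde Z_{\mathcal A}\mid Z_{\mathcal A})=0$, and *falsified signals* of $\mathcal A$ are random $\widetilde X_h\in\mathbb F_q^{x_h}$, $h\in\mathcal A$, with $I(W_{[N]},Z_{[H]\setminus\mathcal A},Q_{[K],[H]\setminus\mathcal A},\mathbf d_{[K]};\widetilde X_{\mathcal A}\mid Z_{\mathcal A},Q_{[K],\mathcal A})=0$. The scheme is *valid* if for all laws of the independent demands, all $\mathcal A,\mathcal J,\mathcal I\subseteq[H]$ with $|\mathcal A|\le A$, $|\mathcal J|=J$, $|\mathcal I|=I$, all falsified contents and signals of $\mathcal A$, all $k\in[K]$ and all $\mathcal S\subseteq[K]$: 1. $I(W_{[N]};Z_{\mathcal I})=0$; 2. $H(W_{[N]}\mid Z_{\mathcal J\setminus\mathcal A},\widetilde Z_{\mathcal J\cap\mathcal A})=0$; 3. $H(W_{\mathbf d_k}\mid X_{\mathcal J\setminus\mathcal A},\widetilde X_{\mathcal J\cap\mathcal A},\mathbf d_k,C_k)=0$; 4. $I(W_{[N]};X_{[H]\setminus\mathcal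 A},\widetilde X_{\mathcal A})=0$; 5. $I(\mathbf d_{[K]\setminus\mathcal S};C_{\mathcal S},\mathbf d_{\mathcal S},Q_{[K],[H]},Z_{[H]}\mid W_{[N]})=0$. A triple $(M,T,R)$ with $M\in[1,N]$ and $T,R\ge0$ is *achievable* if for every $\epsilon>0$ there is a valid scheme, of some file length, with memory size less than $M+\epsilon$, storage size less than $T+\epsilon$ and load less than $R+\epsilon$. It is achievable *with subpacketization $s$* if these schemes can be chosen such that each file is partitioned into $s$ packets of equal length $b$, and, up to headers of caches that depend only on $P_k$ and headers of signals that depend only on the queries, everything stored, cached or sent consists of packets of length $b$ that are linear combinations: of file packets and of packets made from $U$, for servers and caches (coefficients of cached packets may depend on $P_k$), and of packets stored at the server, for signals (coefficients may depend on the queries). The coefficients are taken from a field that contains $\mathbb F_q$ and acts $\mathbb F_q$-linearly on the packets $\mathbb F_q^b$. Let $$T^*(M)=\inf\{T:\exists R,\ (M,T,R)\text{ achievable}\},\qquad R^*(M)=\inf\{R:\exists T,\ (M,T,R)\text{ achievable}\}.$$ **Theorem.** Let $(M,T(M),R(M))$, $M\in[1,N]$, be the curve formed by connecting sequentially, by line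 segments, the points $$(M_t,T_t,R_t)=\Big(1+\frac{t(N-1)}{K},\ \frac1L\Big(N+\frac{K-t}{t+1}\Big),\ \frac{K-t}{L(t+1)}\Big),\qquad t=0,1,\dots,K.$$ (a) Every triple $(M,T,R)$ with $M\in[1,N]$, $T\ge T(M)$ and $R\ge R(M)$ is achievable. (b) For each $t\in\{0,\dots,K\}$ the point $(M_t,T_t,R_t)$ is achievable with subpacketization $L\binom Kt$. (c) For every $M\in[1,N]$, if $K\le N$, or if $K>N$ and $M\ge2$, then $$T(M)\le 2\Big(1+\frac{2A}{L}\Big)T^*(M),\qquad R(M)\le 12\Big(1+\frac{2A}{L}\Big)R^*(M).$$ (These are the bounds $T(M)/T^*(M)\le 2(1+2A/L)$ and $R(M)/R^*(M)\le 12(1+2A/L)$; at $M=N$ both $R(M)$ and $R^*(M)$ are $0$.) -/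

import Mathlib

universe u

namespace BlindServers

noncomputable section

/-! Information measures of finite-valued random variables on a discrete probability space
(natural logarithms). -/

/-- Shannon entropy `H(X)`. -/
def entropy {Ω α : Type*} [Fintype α] (p : PMF Ω) (X : Ω → α) : ℝ :=
  ∑ a, Real.negMulLog ((p.map X a).toReal)

/-- Conditional entropy `H(X | Y) = H(X, Y) - H(Y)`. -/
def condEntropy {Ω α β : Type*} [Fintype α] [Fintype β] (p : PMF Ω)
    (X : Ω → α) (Y : Ω → β) : ℝ :=
  entropy p (fun ω => (X ω, Y ω)) - entropy p Y

/-- Mutual information `I(X; Y) = H(X) + H(Y) - H(X, Y)`. -/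
def mutualInfo {Ω α β : Type*} [Fintype α] [Fintype β] (p : PMF Ω)
    (X : Ω → α) (Y : Ω → β) : ℝ :=
  entropy p X + entropy p Y - entropy p (fun ω => (X ω, Y ω))

/-- Conditional mutual information
`I(X; Y | Z) = H(X, Z) + H(Y, Z) - H(X, Y, Z) - H(Z)`. -/
def condMutualInfo {Ω α β γ : Type*} [Fintype α] [Fintype β] [Fintype γ] (p : PMF Ω)
    (X : Ω → α) (Y : Ω → β) (Z : Ω → γ) : ℝ :=
  entropy p (fun ω => (X ω, Z ω)) + entropy p (fun ω => (Y ω, Z ω))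
    - entropy p (fun ω => (X ω, Y ω, Z ω)) - entropy p Z

/-- The joint law of independent random variables with laws `p 0, …, p (n - 1)`. -/
def productLaw {n : ℕ} {α : Type*} [Fintype α] (p : Fin n → PMF α) : PMF (Fin n → α) :=
  PMF.ofFintype (fun x => ∏ k, p k (x k)) (by
    classical
    rw [← Fintype.prod_sum (fun k a => p k a)]
    exact Finset.prod_eq_one fun k _ => (tsum_fintype (p k)).symm.trans (p k).tsum_coe)

/-- `N` files, each of `B` symbols of `F`. -/
abbrev Files (F : Type u) (N B : ℕ) : Type u := Fin N → Fin B → F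

/-- The data of a scheme for `N` files, `K` users and `H` servers over the finite field `F`:
the file length, the laws of the randomness `U` of the central client and `P k` of user `k`,
and the storage, caching, query and signal functions. Contents are words over `F`; a word of
`n` symbols has normalized size `n / B`. -/
structure Scheme (F : Type u) (N K H : ℕ) where
  /-- the file length -/
  B : ℕ
  B_pos : 0 < B
  /-- alphabet and law of `U` -/
  UAlpha : Type u
  uLaw : PMF UAlpha
  /-- finite alphabet and laws of the `P k` -/
  PAlpha : Type u
  [finP : Fintype PAlpha]
  pLaw : Fin K → PMF PAlpha
  storageLen : ℕ
  cacheLen : ℕ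
  queryLen : Fin K → Fin H → ℕ
  signalLen : Fin H → ℕ
  store : Fin H → Files F N B → UAlpha → (Fin storageLen → F)
  cache : Fin K → PAlpha → UAlpha → Files F N B → (Fin cacheLen → F)
  query : (k : Fin K) → (h : Fin H) → (Fin N → F) → PAlpha → (Fin (queryLen k h) → F)
  signal : (h : Fin H) → (Fin storageLen → F) → ((k : Fin K) → Fin (queryLen k h) → F) →
    (Fin (signalLen h) → F)

attribute [instance] Scheme.finP

namespace Scheme

variable {F : Type u} {N K H : ℕ}

/-- Memory size of the users. -/
def memorySize (S : Scheme F N K H) : ℝ := (S.cacheLen : ℝ) / S.B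

/-- Storage size of the servers. -/
def storageSize (S : Scheme F N K H) : ℝ := (S.storageLen : ℝ) / S.B

/-- Communication load: the largest load of a server. -/
def load (S : Scheme F N K H) : ℝ := ((Finset.univ.sup S.signalLen : ℕ) : ℝ) / S.B

/-- Outcomes of `(W, U, P, d)`: files, client randomness, user randomness, demands. -/
abbrev Sample (S : Scheme F N K H) : Type u :=
  Files F N S.B × S.UAlpha × (Fin K → S.PAlpha) × (Fin K → Fin N → F)

/-- The law of `(W, U, P, d)`: everything is independent, the files are uniform, and `D k` is
the law of the demand of user `k`. -/
def law [Field F] [Fintype F] (S : Scheme F N K H) (D : Fin K → PMF (Fin N → F)) :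
    PMF S.Sample :=
  (PMF.uniformOfFintype (Files F N S.B)).bind fun W =>
    S.uLaw.bind fun U =>
      (productLaw S.pLaw).bind fun P =>
        (productLaw D).map fun d => (W, U, P, d)

variable (S : Scheme F N K H)

/-- The files `W`. -/
def files (ω : S.Sample) : Files F N S.B := ω.1

/-- The demand vectors `d k`. -/
def demand (ω : S.Sample) (k : Fin K) : Fin N → F := ω.2.2.2 k

/-- The demanded linear combination `W_{d k} = ∑ n, d k n • W n`. -/
def wanted [Field F] (k : Fin K) (ω : S.Sample) : Fin S.B → F :=
  ∑ n, S.demand ω k n • S.files ω n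

/-- The content `Z h` of server `h`. -/
def content (ω : S.Sample) (h : Fin H) : Fin S.storageLen → F := S.store h ω.1 ω.2.1

/-- The cache `C k` of user `k`. -/
def userCache (ω : S.Sample) (k : Fin K) : Fin S.cacheLen → F :=
  S.cache k (ω.2.2.1 k) ω.2.1 ω.1

/-- The query `Q k h` of user `k` to server `h`. -/
def userQuery (ω : S.Sample) (k : Fin K) (h : Fin H) : Fin (S.queryLen k h) → F :=
  S.query k h (S.demand ω k) (ω.2.2.1 k)

/-- The signal `X h` that server `h` computes. -/
def serverSignal (ω : S.Sample) (h : Fin H) : Fin (S.signalLen h) → F :=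
  S.signal h (S.content ω h) fun k => S.userQuery ω k h

/-- Values of the contents of the servers in `𝒜`. -/
abbrev ContentsOn (𝒜 : Finset (Fin H)) : Type u := (h : 𝒜) → Fin S.storageLen → F

/-- Values of the signals of the servers in `𝒜`. -/
abbrev SignalsOn (𝒜 : Finset (Fin H)) : Type u := (h : 𝒜) → Fin (S.signalLen h) → F

/-- The contents `Z_𝒜`. -/
def contentsOn (𝒜 : Finset (Fin H)) (ω : S.Sample) : S.ContentsOn 𝒜 := fun h => S.content ω h

/-- The signals `X_𝒜`. -/
def signalsOn (𝒜 : Finset (Fin H)) (ω : S.Sample) : S.SignalsOn 𝒜 :=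
  fun h => S.serverSignal ω h

/-- The queries `Q_{[K], 𝒜}`. -/
def queriesOn (𝒜 : Finset (Fin H)) (ω : S.Sample) :
    (k : Fin K) → (h : 𝒜) → Fin (S.queryLen k h) → F :=
  fun k h => S.userQuery ω k h

variable [Field F] [Fintype F]

/-- `ν` is a joint law of `(W, U, P, d)` and of falsified contents of the servers in `𝒜` with
`I(W, Z_{[H] ∖ 𝒜}; Z̃_𝒜 | Z_𝒜) = 0`. -/
structure IsFalseContent (D : Fin K → PMF (Fin N → F)) (𝒜 : Finset (Fin H))
    (ν : PMF (S.Sample × S.ContentsOn 𝒜)) : Prop where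
  marginal : ν.map Prod.fst = S.law D
  noInfo : condMutualInfo ν
    (fun x => (S.files x.1, S.contentsOn 𝒜ᶜ x.1))
    (fun x => x.2)
    (fun x => S.contentsOn 𝒜 x.1) = 0

/-- `ν` is a joint law of `(W, U, P, d)` and of falsified signals of the servers in `𝒜` with
`I(W, Z_{[H] ∖ 𝒜}, Q_{[K], [H] ∖ 𝒜}, d_{[K]}; X̃_𝒜 | Z_𝒜, Q_{[K], 𝒜}) = 0`. -/
structure IsFalseSignal (D : Fin K → PMF (Fin N → F)) (𝒜 : Finset (Fin H))
    (ν : PMF (S.Sample × S.SignalsOn 𝒜)) : Prop where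
  marginal : ν.map Prod.fst = S.law D
  noInfo : condMutualInfo ν
    (fun x => (S.files x.1, S.contentsOn 𝒜ᶜ x.1, S.queriesOn 𝒜ᶜ x.1, S.demand x.1))
    (fun x => x.2)
    (fun x => (S.contentsOn 𝒜 x.1, S.queriesOn 𝒜 x.1)) = 0

/-- The requirements on a scheme with at most `A` adversarial servers, security against `I`
servers and recovery from `J` servers, whatever the laws of the independent demands are. -/
structure IsValid (A I J : ℕ) : Prop where
  /-- `I(W; Z_ℐ) = 0` -/
  serverSecurity : ∀ D : Fin K → PMF (Fin N → F), ∀ ℐ : Finset (Fin H), ℐ.card = I →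
    mutualInfo (S.law D) S.files (S.contentsOn ℐ) = 0
  /-- `H(W | Z_{𝒥 ∖ 𝒜}, Z̃_{𝒥 ∩ 𝒜}) = 0` -/
  robustRecovery : ∀ D : Fin K → PMF (Fin N → F), ∀ 𝒜 𝒥 : Finset (Fin H),
    𝒜.card ≤ A → 𝒥.card = J →
    ∀ ν : PMF (S.Sample × S.ContentsOn 𝒜), S.IsFalseContent D 𝒜 ν →
      condEntropy ν (fun x => S.files x.1)
        (fun x => (S.contentsOn (𝒥 \ 𝒜) x.1,
          ((fun h => x.2 ⟨h.1, (Finset.mem_inter.mp h.2).2⟩) : S.ContentsOn (𝒥 ∩ 𝒜)))) = 0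
  /-- `H(W_{d k} | X_{𝒥 ∖ 𝒜}, X̃_{𝒥 ∩ 𝒜}, d k, C k) = 0` -/
  robustDecoding : ∀ D : Fin K → PMF (Fin N → F), ∀ 𝒜 𝒥 : Finset (Fin H),
    𝒜.card ≤ A → 𝒥.card = J →
    ∀ ν : PMF (S.Sample × S.SignalsOn 𝒜), S.IsFalseSignal D 𝒜 ν → ∀ k : Fin K,
      condEntropy ν (fun x => S.wanted k x.1)
        (fun x => (S.signalsOn (𝒥 \ 𝒜) x.1,
          ((fun h => x.2 ⟨h.1, (Finset.mem_inter.mp h.2).2⟩) : S.SignalsOn (𝒥 ∩ 𝒜)),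
          S.demand x.1 k, S.userCache x.1 k)) = 0
  /-- `I(W; X_{[H] ∖ 𝒜}, X̃_𝒜) = 0` -/
  signalSecurity : ∀ D : Fin K → PMF (Fin N → F), ∀ 𝒜 : Finset (Fin H), 𝒜.card ≤ A →
    ∀ ν : PMF (S.Sample × S.SignalsOn 𝒜), S.IsFalseSignal D 𝒜 ν →
      mutualInfo ν (fun x => S.files x.1) (fun x => (S.signalsOn 𝒜ᶜ x.1, x.2)) = 0
  /-- `I(d_{[K] ∖ 𝒮}; C_𝒮, d_𝒮, Q_{[K], [H]}, Z_{[H]} | W) = 0` -/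
  demandPrivacy : ∀ D : Fin K → PMF (Fin N → F), ∀ 𝒮 : Finset (Fin K),
    condMutualInfo (S.law D)
      (fun ω => fun k : (𝒮ᶜ : Finset (Fin K)) => S.demand ω k)
      (fun ω => ((fun k : 𝒮 => S.userCache ω k), (fun k : 𝒮 => S.demand ω k),
        S.userQuery ω, S.content ω))
      S.files = 0

/-- An implementation of the scheme that partitions each file into `s` packets of equal length
`b`. Everything that depends on the files or on `U` is handled packetwise: each server stores
packets, which are linear combinations of file packets and key packets (packets made from
`U`); each user caches packets of this kind, with coefficients that may depend on its own
randomness; each server transmits linear combinations of its stored packets, with coefficients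
that may depend on the queries. Apart from packets, a cache may hold a header that depends
only on the user's randomness, and a signal a header that depends only on the queries.
Coefficients come from a field that contains `F` and acts linearly on the packets `F ^ b`. -/
structure Packetization (s : ℕ) where
  b : ℕ
  coef : Subalgebra F (Module.End F (Fin b → F))
  coef_isField : IsField coef
  /-- symbol `x` of packet `j` of a file sits at position `filePos (j, x)` -/
  filePos : Fin s × Fin b ≃ Fin S.B
  keyCount : ℕ
  key : S.UAlpha → Fin keyCount → (Fin b → F)
  storeCount : ℕ
  storePos : Fin storeCount × Fin b ≃ Fin S.storageLen
  storeFile : Fin H → Fin storeCount → Fin N → Fin s → coef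
  storeKey : Fin H → Fin storeCount → Fin keyCount → coef
  store_eq : ∀ h W U i, (fun x => S.store h W U (storePos (i, x))) =
    (∑ n, ∑ j, (storeFile h i n j).1 (fun x => W n (filePos (j, x)))) +
      ∑ m, (storeKey h i m).1 (key U m)
  cacheHeaderLen : ℕ
  cacheCount : ℕ
  cachePos : Fin cacheHeaderLen ⊕ (Fin cacheCount × Fin b) ≃ Fin S.cacheLen
  cacheHeader : Fin K → S.PAlpha → (Fin cacheHeaderLen → F)
  cacheFile : Fin K → S.PAlpha → Fin cacheCount → Fin N → Fin s → coef
  cacheKey : Fin K → S.PAlpha → Fin cacheCount → Fin keyCount → coef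
  cacheHeader_eq : ∀ k P U W i, S.cache k P U W (cachePos (Sum.inl i)) = cacheHeader k P i
  cache_eq : ∀ k P U W i, (fun x => S.cache k P U W (cachePos (Sum.inr (i, x)))) =
    (∑ n, ∑ j, (cacheFile k P i n j).1 (fun x => W n (filePos (j, x)))) +
      ∑ m, (cacheKey k P i m).1 (key U m)
  signalHeaderLen : Fin H → ℕ
  signalCount : Fin H → ℕ
  signalPos : (h : Fin H) →
    Fin (signalHeaderLen h) ⊕ (Fin (signalCount h) × Fin b) ≃ Fin (S.signalLen h)
  signalHeader : (h : Fin H) → ((k : Fin K) → Fin (S.queryLen k h) → F) →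
    (Fin (signalHeaderLen h) → F)
  signalCoef : (h : Fin H) → ((k : Fin K) → Fin (S.queryLen k h) → F) →
    Fin (signalCount h) → Fin storeCount → coef
  signalHeader_eq : ∀ h Z Q i, S.signal h Z Q (signalPos h (Sum.inl i)) = signalHeader h Q i
  signal_eq : ∀ h Z Q i, (fun x => S.signal h Z Q (signalPos h (Sum.inr (i, x)))) =
    ∑ m, (signalCoef h Q i m).1 (fun x => Z (storePos (m, x)))

end Scheme

section Region

variable (F : Type u) [Field F] [Fintype F] (N K H A I J : ℕ)

/-- The triple `(M, T, R)` is achievable: for every `ε > 0` some valid scheme (with some file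
length) has memory size below `M + ε`, storage size below `T + ε` and load below `R + ε`. -/
def Achievable (M T R : ℝ) : Prop :=
  1 ≤ M ∧ M ≤ N ∧ 0 ≤ T ∧ 0 ≤ R ∧
    ∀ ε : ℝ, 0 < ε → ∃ S : Scheme F N K H, S.IsValid A I J ∧
      S.memorySize < M + ε ∧ S.storageSize < T + ε ∧ S.load < R + ε

/-- The triple `(M, T, R)` is achieved by schemes that partition each file into `s` packets. -/
def AchievableWithPackets (s : ℕ) (M T R : ℝ) : Prop :=
  1 ≤ M ∧ M ≤ N ∧ 0 ≤ T ∧ 0 ≤ R ∧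
    ∀ ε : ℝ, 0 < ε → ∃ S : Scheme F N K H, S.IsValid A I J ∧
      S.memorySize < M + ε ∧ S.storageSize < T + ε ∧ S.load < R + ε ∧
      Nonempty (S.Packetization s)

/-- The optimal storage size `T*(M)`. -/
def optStorage (M : ℝ) : ℝ := sInf {T : ℝ | ∃ R : ℝ, Achievable F N K H A I J M T R}

/-- The optimal communication load `R*(M)`. -/
def optLoad (M : ℝ) : ℝ := sInf {R : ℝ | ∃ T : ℝ, Achievable F N K H A I J M T R}

end Region

/-- `L = J - I - 2A`. -/
def numSubfiles (A I J : ℕ) : ℕ := J - I - 2 * A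

/-- `M_t = 1 + t (N - 1) / K`. -/
def memPoint (N K t : ℕ) : ℝ := 1 + (t : ℝ) * ((N : ℝ) - 1) / K

/-- `T_t = (N + (K - t) / (t + 1)) / L`. -/
def storagePoint (N K L t : ℕ) : ℝ := 1 / (L : ℝ) * ((N : ℝ) + ((K : ℝ) - t) / ((t : ℝ) + 1))

/-- `R_t = (K - t) / (L (t + 1))`. -/
def loadPoint (K L t : ℕ) : ℝ := ((K : ℝ) - t) / ((L : ℝ) * ((t : ℝ) + 1))

/-- The function on `[1, N]` whose graph connects the points `(M_t, y t)`, `t = 0, …, K`,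
sequentially by line segments. -/
def interpolate (N K : ℕ) (y : ℕ → ℝ) (M : ℝ) : ℝ :=
  let τ : ℝ := (K : ℝ) * (M - 1) / ((N : ℝ) - 1)
  y ⌊τ⌋₊ + (τ - ⌊τ⌋₊) * (y (⌊τ⌋₊ + 1) - y ⌊τ⌋₊)

/-- The function `interpolate` does run along the segments. -/
theorem interpolate_segment {N K : ℕ} (hN : 2 ≤ N) (hK : 0 < K) (y : ℕ → ℝ) (t : ℕ)
    {θ : ℝ} (h0 : 0 ≤ θ) (h1 : θ ≤ 1) :
    interpolate N K y ((1 - θ) * memPoint N K t + θ * memPoint N K (t + 1)) =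
      (1 - θ) * y t + θ * y (t + 1) := by
  have hN' : (N : ℝ) - 1 ≠ 0 := by
    have : (2 : ℝ) ≤ N := by exact_mod_cast hN
    intro h; linarith
  have hK' : (K : ℝ) ≠ 0 := by exact_mod_cast hK.ne'
  have hτ : (K : ℝ) * (((1 - θ) * memPoint N K t + θ * memPoint N K (t + 1)) - 1) /
      ((N : ℝ) - 1) = t + θ := by
    unfold memPoint
    push_cast
    field_simp
    ring
  unfold interpolate
  simp only [hτ]
  rcases h1.lt_or_eq with h | h
  · have hf : ⌊(t : ℝ) + θ⌋₊ = t := by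
      rw [Nat.floor_eq_iff (by positivity)]
      constructor <;> linarith
    rw [hf]; ring
  · subst h
    have hf : ⌊(t : ℝ) + 1⌋₊ = t + 1 := by exact_mod_cast Nat.floor_natCast (R := ℝ) (t + 1)
    rw [hf]; push_cast; ring

/-- The storage coordinate `T(M)` of the curve. -/
def curveStorage (N K L : ℕ) (M : ℝ) : ℝ := interpolate N K (storagePoint N K L) M

/-- The load coordinate `R(M)` of the curve. -/
def curveLoad (N K L : ℕ) (M : ℝ) : ℝ := interpolate N K (loadPoint K L) M

end

end BlindServers

/-! Achievability. A file is cut into packets W_n(a, l), where a is a set of t users and l < L; a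
packet is an element of an extension E of F of degree m. For each n and a, I uniform packets
followed by the L data packets are the coefficients of a polynomial of degree below I + L, and each
server stores its value at the server's own point of E. Each set s of t + 1 users has a key, a
uniform vector of I + L packets, shared in the same way. User k holds a uniform mask p_k, all data
packets with k ∈ a, and for k ∉ a the sum of the data packet of the key of a ∪ {k} and p_k · W(a).
Its query is d_k + p_k. For each s a server sends its key share plus the query-weighted sum of its
shares of the sets s \ {k}, k ∈ s. By linearity this is a share of a single vector, which I + L
honest signals determine. User k has cached what occurs in it apart from the term of s \ {k};
subtracting also its masked key leaves d_k · W(s \ {k}) (`decode_eq`).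

Privacy and security are symmetries of the sample space. Moving a vector from p_k to d_k changes no
query, which gives `CodedData.demand_private`. A change of the files can be compensated by the
random packets so that all signals and the contents of at most I servers stay fixed, which gives
`CodedData.files_indep`; as A ≤ I, this covers all that adversaries know, and falsification adds
nothing (`Scheme.mutualInfo_false_signals`). Headers have fixed length, so their cost vanishes as m
grows. Subfiles of several levels t, kept apart by a layer index, give the points between the
corners (`exists_scheme_near_mean`).

Converse. By server security one value of the contents of I servers is compatible with all files
(`Scheme.IsValid.exists_common_contents`). With these contents frozen, J - I further servers
determine the files, and their signals in m transmissions together with s caches determine m s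
files. Counting words gives N ≤ (J - I) T and s - s M / m ≤ (J - I) R. Since 1 + 2A / L = (J - I) /
L, the comparison reduces to f ≤ N and f ≤ 12 (s - s M / m) for suitable s and m, where f is the
load of the curve for L = 1; the second inequality is `exists_cutset`. -/

namespace BlindServers

noncomputable section

/-! ### Masses of finite-valued random variables -/

/-- The probability that `X` takes the value `a`. -/
def prob {Ω α : Type*} (p : PMF Ω) (X : Ω → α) (a : α) : ℝ := (p.map X a).toReal

section Prob

variable {Ω α β γ : Type*} (p : PMF Ω)

theorem prob_nonneg (X : Ω → α) (a : α) : 0 ≤ prob p X a := ENNReal.toReal_nonneg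

theorem sum_prob [Fintype α] (X : Ω → α) : ∑ a, prob p X a = 1 := by
  unfold prob
  rw [← ENNReal.toReal_sum fun a _ => PMF.apply_ne_top _ a]
  have := (p.map X).tsum_coe
  rw [tsum_fintype] at this
  rw [this, ENNReal.toReal_one]

theorem prob_comp [Fintype α] [DecidableEq β] (X : Ω → α) (f : α → β) (b : β) :
    prob p (fun ω => f (X ω)) b = ∑ a, if b = f a then prob p X a else 0 := by
  unfold prob
  have h : p.map (fun ω => f (X ω)) = (p.map X).map f := by
    rw [PMF.map_comp]; rfl
  rw [h, PMF.map_apply, tsum_fintype, ENNReal.toReal_sum]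
  · refine Finset.sum_congr rfl fun a _ => ?_
    by_cases hb : b = f a
    · simp only [if_pos hb]
    · simp only [if_neg hb, ENNReal.toReal_zero]
  · intro a _
    split_ifs
    · exact PMF.apply_ne_top _ a
    · exact ENNReal.zero_ne_top

/-- The bridge from masses to outcomes: positivity of a mass produces a point of the support, and
conversely. -/
theorem prob_ne_zero {X : Ω → α} {a : α} :
    prob p X a ≠ 0 ↔ ∃ ω ∈ p.support, X ω = a := by
  unfold prob
  rw [Ne, ENNReal.toReal_eq_zero_iff, not_or, ← PMF.mem_support_map_iff, PMF.mem_support_iff]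
  exact ⟨fun h => h.1, fun h => ⟨h, PMF.apply_ne_top _ _⟩⟩

theorem prob_comp_injective {X : Ω → α} (f : α → β) (hf : Function.Injective f) (a : α) :
    prob p (fun ω => f (X ω)) (f a) = prob p X a := by
  unfold prob
  rw [PMF.map_apply, PMF.map_apply]
  congr 1
  refine tsum_congr fun ω => ?_
  by_cases h : a = X ω
  · rw [if_pos h, if_pos (congrArg f h)]
  · rw [if_neg h, if_neg fun h' => h (hf h')]

theorem prob_fst [Fintype α] [Fintype β] (X : Ω → α) (Y : Ω → β) (a : α) :
    prob p X a = ∑ b, prob p (fun ω => (X ω, Y ω)) (a, b) := by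
  classical
  rw [show X = fun ω => Prod.fst (X ω, Y ω) from rfl, prob_comp, Fintype.sum_prod_type,
    Finset.sum_eq_single_of_mem a (Finset.mem_univ a) fun b _ hb => by simp [hb.symm]]
  simp

theorem prob_snd [Fintype α] [Fintype β] (X : Ω → α) (Y : Ω → β) (b : β) :
    prob p Y b = ∑ a, prob p (fun ω => (X ω, Y ω)) (a, b) := by
  classical
  rw [show Y = fun ω => Prod.snd (X ω, Y ω) from rfl, prob_comp, Fintype.sum_prod_type_right,
    Finset.sum_eq_single_of_mem b (Finset.mem_univ b) fun a _ ha => by simp [ha.symm]]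
  simp

theorem prob_pair_le_snd [Fintype α] [Fintype β] (X : Ω → α) (Y : Ω → β) (a : α) (b : β) :
    prob p (fun ω => (X ω, Y ω)) (a, b) ≤ prob p Y b := by
  rw [prob_snd p X Y b]
  exact Finset.single_le_sum (f := fun a => prob p (fun ω => (X ω, Y ω)) (a, b))
    (fun _ _ => prob_nonneg _ _ _) (Finset.mem_univ a)

theorem prob_skip_fst [Fintype α] [Fintype β] [Fintype γ] (X : Ω → α) (Y : Ω → β) (Z : Ω → γ)
    (y : β) (z : γ) : prob p (fun ω => (Y ω, Z ω)) (y, z) =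
      ∑ x, prob p (fun ω => (X ω, Y ω, Z ω)) (x, y, z) :=
  prob_snd p X (fun ω => (Y ω, Z ω)) (y, z)

theorem prob_skip_snd [Fintype α] [Fintype β] [Fintype γ] (X : Ω → α) (Y : Ω → β) (Z : Ω → γ)
    (x : α) (z : γ) : prob p (fun ω => (X ω, Z ω)) (x, z) =
      ∑ y, prob p (fun ω => (X ω, Y ω, Z ω)) (x, y, z) := by
  rw [prob_snd p Y (fun ω => (X ω, Z ω)) (x, z)]
  refine Finset.sum_congr rfl fun y _ => ?_
  have hinj : Function.Injective (fun t : α × β × γ => (t.2.1, t.1, t.2.2)) := by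
    rintro ⟨a, b, c⟩ ⟨a', b', c'⟩ h
    simp only [Prod.mk.injEq] at h ⊢
    tauto
  exact prob_comp_injective p (X := fun ω => (X ω, Y ω, Z ω)) _ hinj (x, y, z)

theorem entropy_eq [Fintype α] (X : Ω → α) :
    entropy p X = ∑ a, Real.negMulLog (prob p X a) := rfl

theorem entropy_comp_equiv [Fintype α] [Fintype β] (X : Ω → α) (e : α ≃ β) :
    entropy p (fun ω => e (X ω)) = entropy p X := by
  rw [entropy_eq, entropy_eq, ← e.sum_comp]
  refine Finset.sum_congr rfl fun a _ => ?_
  rw [prob_comp_injective p (fun a => e a) e.injective]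

/-! ### Vanishing of information measures -/

theorem condEntropy_eq_sum [Fintype α] [Fintype β] (X : Ω → α) (Y : Ω → β) :
    condEntropy p X Y = ∑ a, ∑ b, prob p (fun ω => (X ω, Y ω)) (a, b) *
      (Real.log (prob p Y b) - Real.log (prob p (fun ω => (X ω, Y ω)) (a, b))) := by
  unfold condEntropy
  rw [entropy_eq, entropy_eq, Fintype.sum_prod_type]
  simp_rw [Real.negMulLog, mul_sub, Finset.sum_sub_distrib]
  rw [Finset.sum_comm (f := fun a b => prob p (fun ω => (X ω, Y ω)) (a, b) *
    Real.log (prob p Y b))]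
  simp_rw [← Finset.sum_mul, ← prob_snd]
  simp only [neg_mul, Finset.sum_neg_distrib]
  ring

/-- All terms of the sum in `condEntropy_eq_sum` are nonnegative, so each must vanish, and then
every pair of positive mass exhausts the mass of its second entry. In this form recovery and
decoding need no entropy. -/
theorem condEntropy_eq_zero_iff [Fintype α] [Fintype β] (X : Ω → α) (Y : Ω → β) :
    condEntropy p X Y = 0 ↔
      ∀ ω ∈ p.support, ∀ ω' ∈ p.support, Y ω = Y ω' → X ω = X ω' := by
  have hterm : ∀ a b, 0 ≤ prob p (fun ω => (X ω, Y ω)) (a, b) *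
      (Real.log (prob p Y b) - Real.log (prob p (fun ω => (X ω, Y ω)) (a, b))) := by
    intro a b
    rcases (prob_nonneg p (fun ω => (X ω, Y ω)) (a, b)).eq_or_lt with h | h
    · rw [← h, zero_mul]
    · exact mul_nonneg h.le (sub_nonneg.2 (Real.log_le_log h (prob_pair_le_snd p X Y a b)))
  rw [condEntropy_eq_sum]
  constructor
  · intro h ω hω ω' hω' hY
    by_contra hne
    have h1 := (Finset.sum_eq_zero_iff_of_nonneg
      (fun a _ => Finset.sum_nonneg fun b _ => hterm a b)).1 h
    have hz : ∀ a b, prob p (fun ω => (X ω, Y ω)) (a, b) *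
      (Real.log (prob p Y b) - Real.log (prob p (fun ω => (X ω, Y ω)) (a, b))) = 0 := fun a b =>
      (Finset.sum_eq_zero_iff_of_nonneg (fun b _ => hterm a b)).1 (h1 a (Finset.mem_univ a)) b
        (Finset.mem_univ b)
    have hp : prob p (fun ω => (X ω, Y ω)) (X ω, Y ω) ≠ 0 := (prob_ne_zero p).2 ⟨ω, hω, rfl⟩
    have hp' : prob p (fun ω => (X ω, Y ω)) (X ω', Y ω) ≠ 0 :=
      (prob_ne_zero p).2 ⟨ω', hω', by rw [hY]⟩
    have hY0 : prob p Y (Y ω) ≠ 0 := (prob_ne_zero p).2 ⟨ω, hω, rfl⟩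
    have heq : prob p Y (Y ω) = prob p (fun ω => (X ω, Y ω)) (X ω, Y ω) := by
      have := (mul_eq_zero.1 (hz (X ω) (Y ω))).resolve_left hp
      exact Real.log_injOn_pos (lt_of_le_of_ne (prob_nonneg _ _ _) hY0.symm)
        (lt_of_le_of_ne (prob_nonneg _ _ _) hp.symm) (sub_eq_zero.1 this)
    classical
    -- Two different values of `X` over the same value of `Y` would both have positive mass, while
    -- the first one already has all of it.
    have hle : prob p (fun ω => (X ω, Y ω)) (X ω, Y ω) +
        prob p (fun ω => (X ω, Y ω)) (X ω', Y ω) ≤ prob p Y (Y ω) := by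
      rw [prob_snd p X Y (Y ω), ← Finset.sum_pair
        (f := fun a => prob p (fun ω => (X ω, Y ω)) (a, Y ω)) hne]
      exact Finset.sum_le_sum_of_subset_of_nonneg (Finset.subset_univ _)
        fun _ _ _ => prob_nonneg _ _ _
    have := lt_of_le_of_ne (prob_nonneg p (fun ω => (X ω, Y ω)) (X ω', Y ω)) hp'.symm
    linarith
  · intro h
    refine Finset.sum_eq_zero fun a _ => Finset.sum_eq_zero fun b _ => ?_
    by_cases hp : prob p (fun ω => (X ω, Y ω)) (a, b) = 0
    · rw [hp, zero_mul]
    · obtain ⟨ω, hω, he⟩ := (prob_ne_zero p).1 hp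
      have : prob p Y b = prob p (fun ω => (X ω, Y ω)) (a, b) := by
        rw [prob_snd p X Y b]
        refine Finset.sum_eq_single_of_mem a (Finset.mem_univ a) fun a' _ ha' => ?_
        by_contra hq
        obtain ⟨ω', hω', he'⟩ := (prob_ne_zero p).1 hq
        simp only [Prod.mk.injEq] at he he'
        exact ha' (he'.1.symm.trans ((h ω' hω' ω hω (he'.2.trans he.2.symm)).trans he.1))
      rw [this, sub_self, mul_zero]

/-- The conditional mutual information as a sum of nonnegative terms. -/
theorem condMutualInfo_eq_sum [Fintype α] [Fintype β] [Fintype γ]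
    (X : Ω → α) (Y : Ω → β) (Z : Ω → γ) :
    condMutualInfo p X Y Z = ∑ x, ∑ y, ∑ z,
      (prob p (fun ω => (X ω, Z ω)) (x, z) * prob p (fun ω => (Y ω, Z ω)) (y, z) / prob p Z z) *
        InformationTheory.klFun (prob p (fun ω => (X ω, Y ω, Z ω)) (x, y, z) /
          (prob p (fun ω => (X ω, Z ω)) (x, z) * prob p (fun ω => (Y ω, Z ω)) (y, z) /
            prob p Z z)) := by
  set P := fun x y z => prob p (fun ω => (X ω, Y ω, Z ω)) (x, y, z) with hP
  set PX := fun x z => prob p (fun ω => (X ω, Z ω)) (x, z) with hPX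
  set PY := fun y z => prob p (fun ω => (Y ω, Z ω)) (y, z) with hPY
  set PZ := fun z => prob p Z z with hPZ
  have hX : ∀ x z, PX x z = ∑ y, P x y z := fun x z => prob_skip_snd p X Y Z x z
  have hY : ∀ y z, PY y z = ∑ x, P x y z := fun y z => prob_skip_fst p X Y Z y z
  have hZX : ∀ z, PZ z = ∑ x, PX x z := fun z => prob_snd p X Z z
  have hZY : ∀ z, PZ z = ∑ y, PY y z := fun z => prob_snd p Y Z z
  have hZ1 : ∑ z, PZ z = 1 := sum_prob p Z
  have hPXle : ∀ x y z, P x y z ≠ 0 → PX x z ≠ 0 := fun x y z h => by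
    obtain ⟨ω, hω, he⟩ := (prob_ne_zero p).1 h
    simp only [Prod.mk.injEq] at he
    exact (prob_ne_zero p).2 ⟨ω, hω, by simp [he]⟩
  have hPYle : ∀ x y z, P x y z ≠ 0 → PY y z ≠ 0 := fun x y z h => by
    obtain ⟨ω, hω, he⟩ := (prob_ne_zero p).1 h
    simp only [Prod.mk.injEq] at he
    exact (prob_ne_zero p).2 ⟨ω, hω, by simp [he]⟩
  have hPZle : ∀ x y z, P x y z ≠ 0 → PZ z ≠ 0 := fun x y z h => by
    obtain ⟨ω, hω, he⟩ := (prob_ne_zero p).1 h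
    simp only [Prod.mk.injEq] at he
    exact (prob_ne_zero p).2 ⟨ω, hω, by simp [he]⟩
  -- With `klFun x = x log x + 1 - x`, each term is the usual logarithmic one plus q - P, where q =
  -- PX PY / PZ. The correction cancels in the total because P and q both have mass 1.
  have hterm : ∀ x y z, PX x z * PY y z / PZ z *
      InformationTheory.klFun (P x y z / (PX x z * PY y z / PZ z)) =
      (P x y z * Real.log (P x y z) + P x y z * Real.log (PZ z) - P x y z * Real.log (PX x z)
        - P x y z * Real.log (PY y z)) + PX x z * PY y z / PZ z - P x y z := by
    intro x y z
    rw [InformationTheory.klFun_apply]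
    by_cases h : P x y z = 0
    · simp [h]
    · have h1 := hPXle x y z h
      have h2 := hPYle x y z h
      have h3 := hPZle x y z h
      rw [Real.log_div h (by positivity), Real.log_div (by positivity) h3, Real.log_mul h1 h2]
      field_simp
      ring
  have hQ : ∑ x, ∑ y, ∑ z, PX x z * PY y z / PZ z = 1 := by
    have : ∀ z, ∑ x, ∑ y, PX x z * PY y z / PZ z = PZ z := fun z => by
      simp_rw [← Finset.sum_div, ← Finset.mul_sum, ← hZY, ← Finset.sum_mul, ← hZX]
      exact mul_self_div_self _
    rw [← hZ1, ← Finset.sum_congr rfl fun z _ => this z, Finset.sum_comm (γ := γ)]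
    exact Finset.sum_congr rfl fun x _ => Finset.sum_comm
  have hP1 : ∑ x, ∑ y, ∑ z, P x y z = 1 := by
    rw [← sum_prob p (fun ω => (X ω, Y ω, Z ω)), Fintype.sum_prod_type]
    simp_rw [Fintype.sum_prod_type]
    rfl
  have e1 : entropy p (fun ω => (X ω, Z ω)) = - ∑ x, ∑ y, ∑ z, P x y z * Real.log (PX x z) := by
    rw [entropy_eq, Fintype.sum_prod_type, ← Finset.sum_neg_distrib]
    refine Finset.sum_congr rfl fun x _ => ?_
    rw [Finset.sum_comm, ← Finset.sum_neg_distrib]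
    refine Finset.sum_congr rfl fun z _ => ?_
    rw [← Finset.sum_mul, ← hX, Real.negMulLog, neg_mul]
  have e2 : entropy p (fun ω => (Y ω, Z ω)) = - ∑ x, ∑ y, ∑ z, P x y z * Real.log (PY y z) := by
    rw [entropy_eq, Fintype.sum_prod_type,
      Finset.sum_comm (f := fun x y => ∑ z, P x y z * Real.log (PY y z)),
      ← Finset.sum_neg_distrib]
    refine Finset.sum_congr rfl fun y _ => ?_
    rw [Finset.sum_comm, ← Finset.sum_neg_distrib]
    refine Finset.sum_congr rfl fun z _ => ?_
    rw [← Finset.sum_mul, ← hY, Real.negMulLog, neg_mul]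
  have e3 : entropy p (fun ω => (X ω, Y ω, Z ω)) =
      - ∑ x, ∑ y, ∑ z, P x y z * Real.log (P x y z) := by
    rw [entropy_eq, Fintype.sum_prod_type, ← Finset.sum_neg_distrib]
    refine Finset.sum_congr rfl fun x _ => ?_
    rw [Fintype.sum_prod_type, ← Finset.sum_neg_distrib]
    refine Finset.sum_congr rfl fun y _ => ?_
    rw [← Finset.sum_neg_distrib]
    refine Finset.sum_congr rfl fun z _ => ?_
    rw [Real.negMulLog, neg_mul]
  have e4 : entropy p Z = - ∑ x, ∑ y, ∑ z, P x y z * Real.log (PZ z) := by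
    have : ∀ x, ∑ y, ∑ z, P x y z * Real.log (PZ z) = ∑ z, PX x z * Real.log (PZ z) := fun x => by
      rw [Finset.sum_comm]
      refine Finset.sum_congr rfl fun z _ => ?_
      rw [← Finset.sum_mul, ← hX]
    simp_rw [this]
    rw [entropy_eq, Finset.sum_comm, ← Finset.sum_neg_distrib]
    refine Finset.sum_congr rfl fun z _ => ?_
    rw [← Finset.sum_mul, ← hZX, Real.negMulLog, neg_mul]
  unfold condMutualInfo
  rw [e1, e2, e3, e4]
  change _ = ∑ x, ∑ y, ∑ z, PX x z * PY y z / PZ z *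
      InformationTheory.klFun (P x y z / (PX x z * PY y z / PZ z))
  simp_rw [hterm, Finset.sum_sub_distrib, Finset.sum_add_distrib, Finset.sum_sub_distrib,
    Finset.sum_add_distrib]
  rw [hQ, hP1]
  ring

/-- A sum of nonnegative terms q · klFun(P / q) vanishes only if every term does, and `klFun`
vanishes only at 1. Multiplying out by the mass of z makes the criterion meaningful on null values
of `Z`. -/
theorem condMutualInfo_eq_zero_iff [Fintype α] [Fintype β] [Fintype γ]
    (X : Ω → α) (Y : Ω → β) (Z : Ω → γ) :
    condMutualInfo p X Y Z = 0 ↔ ∀ x y z,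
      prob p (fun ω => (X ω, Y ω, Z ω)) (x, y, z) * prob p Z z =
        prob p (fun ω => (X ω, Z ω)) (x, z) * prob p (fun ω => (Y ω, Z ω)) (y, z) := by
  have hq : ∀ x y z, 0 ≤ prob p (fun ω => (X ω, Z ω)) (x, z) *
      prob p (fun ω => (Y ω, Z ω)) (y, z) / prob p Z z := fun x y z =>
    div_nonneg (mul_nonneg (prob_nonneg _ _ _) (prob_nonneg _ _ _)) (prob_nonneg _ _ _)
  have hk : ∀ x y z, 0 ≤ (prob p (fun ω => (X ω, Z ω)) (x, z) *
      prob p (fun ω => (Y ω, Z ω)) (y, z) / prob p Z z) *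
        InformationTheory.klFun (prob p (fun ω => (X ω, Y ω, Z ω)) (x, y, z) /
          (prob p (fun ω => (X ω, Z ω)) (x, z) * prob p (fun ω => (Y ω, Z ω)) (y, z) /
            prob p Z z)) := fun x y z =>
    mul_nonneg (hq x y z) (InformationTheory.klFun_nonneg
      (div_nonneg (prob_nonneg _ _ _) (hq x y z)))
  have hsupp : ∀ x y z, prob p (fun ω => (X ω, Y ω, Z ω)) (x, y, z) ≠ 0 →
      prob p (fun ω => (X ω, Z ω)) (x, z) ≠ 0 ∧ prob p (fun ω => (Y ω, Z ω)) (y, z) ≠ 0 ∧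
        prob p Z z ≠ 0 := fun x y z h => by
    obtain ⟨ω, hω, he⟩ := (prob_ne_zero p).1 h
    simp only [Prod.mk.injEq] at he
    exact ⟨(prob_ne_zero p).2 ⟨ω, hω, by simp [he]⟩, (prob_ne_zero p).2 ⟨ω, hω, by simp [he]⟩,
      (prob_ne_zero p).2 ⟨ω, hω, by simp [he]⟩⟩
  rw [condMutualInfo_eq_sum]
  constructor
  · intro h x y z
    have h1 := (Finset.sum_eq_zero_iff_of_nonneg fun x _ => Finset.sum_nonneg fun y _ =>
      Finset.sum_nonneg fun z _ => hk x y z).1 h x (Finset.mem_univ x)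
    have h2 := (Finset.sum_eq_zero_iff_of_nonneg fun y _ =>
      Finset.sum_nonneg fun z _ => hk x y z).1 h1 y (Finset.mem_univ y)
    have h3 := (Finset.sum_eq_zero_iff_of_nonneg fun z _ => hk x y z).1 h2 z (Finset.mem_univ z)
    by_cases hz : prob p Z z = 0
    · have : prob p (fun ω => (X ω, Z ω)) (x, z) = 0 :=
        le_antisymm (hz ▸ prob_pair_le_snd p X Z x z) (prob_nonneg _ _ _)
      rw [hz, this]; simp
    · rcases mul_eq_zero.1 h3 with h4 | h4
      · rw [div_eq_zero_iff, or_iff_left hz] at h4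
        rw [h4]
        by_contra hne
        have := hsupp x y z (left_ne_zero_of_mul hne)
        exact (mul_ne_zero this.1 this.2.1) h4
      · rw [InformationTheory.klFun_eq_zero_iff (div_nonneg (prob_nonneg _ _ _) (hq x y z))] at h4
        -- The denominator is nonzero: otherwise the quotient would be 0 by convention, not 1.
        have h5 := (div_eq_one_iff_eq (fun h0 => by rw [h0, div_zero] at h4; norm_num at h4)).1 h4
        rw [h5]
        field_simp
  · intro h
    refine Finset.sum_eq_zero fun x _ => Finset.sum_eq_zero fun y _ =>
      Finset.sum_eq_zero fun z _ => ?_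
    by_cases hz : prob p Z z = 0
    · simp [hz]
    · rw [← h x y z, mul_div_cancel_right₀ _ hz]
      by_cases h0 : prob p (fun ω => (X ω, Y ω, Z ω)) (x, y, z) = 0
      · simp [h0]
      · rw [div_self h0, InformationTheory.klFun_one, mul_zero]

theorem prob_const [DecidableEq α] (a b : α) :
    prob p (fun _ => a) b = if b = a then 1 else 0 := by
  unfold prob
  rw [show (fun _ : Ω => a) = Function.const Ω a from rfl, PMF.map_const, PMF.pure_apply]
  split_ifs <;> simp

theorem entropy_unit : entropy p (fun _ => ()) = 0 := by
  classical
  simp [entropy_eq, prob_const]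

theorem mutualInfo_eq_condMutualInfo [Fintype α] [Fintype β] (X : Ω → α) (Y : Ω → β) :
    mutualInfo p X Y = condMutualInfo p X Y (fun _ => ()) := by
  unfold mutualInfo condMutualInfo
  rw [entropy_unit, ← entropy_comp_equiv p X (Equiv.prodPUnit α : α × Unit ≃ α).symm,
    ← entropy_comp_equiv p Y (Equiv.prodPUnit β : β × Unit ≃ β).symm,
    ← entropy_comp_equiv p (fun ω => (X ω, Y ω))
      ((Equiv.refl α).prodCongr (Equiv.prodPUnit β : β × Unit ≃ β).symm), sub_zero]
  rfl

theorem prob_pair_unit (X : Ω → α) (a : α) :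
    prob p (fun ω => (X ω, ())) (a, ()) = prob p X a :=
  prob_comp_injective p (fun a => (a, ())) (fun a b h => by simpa using h) a

theorem mutualInfo_eq_zero_iff [Fintype α] [Fintype β] (X : Ω → α) (Y : Ω → β) :
    mutualInfo p X Y = 0 ↔ ∀ x y,
      prob p (fun ω => (X ω, Y ω)) (x, y) = prob p X x * prob p Y y := by
  classical
  rw [mutualInfo_eq_condMutualInfo, condMutualInfo_eq_zero_iff]
  have h1 : prob p (fun _ => ()) () = 1 := by simp [prob_const]
  have h3 : ∀ x y, prob p (fun ω => (X ω, Y ω, ())) (x, y, ()) =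
      prob p (fun ω => (X ω, Y ω)) (x, y) := fun x y =>
    prob_comp_injective p (X := fun ω => (X ω, Y ω)) (fun v : α × β => (v.1, v.2, ()))
      (fun a b h => by simpa [Prod.ext_iff] using h) (x, y)
  constructor
  · intro h x y
    have := h x y ()
    rwa [h1, mul_one, h3, prob_pair_unit, prob_pair_unit] at this
  · intro h x y z
    rw [h1, mul_one, h3, prob_pair_unit, prob_pair_unit, h]

/-- Serves the empty set of adversaries, whose falsified data has a single value. -/
theorem condMutualInfo_const_middle [Fintype α] [Fintype β] [Fintype γ] [Unique β]
    (X : Ω → α) (Y : Ω → β) (Z : Ω → γ) : condMutualInfo p X Y Z = 0 := by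
  rw [condMutualInfo_eq_zero_iff]
  intro x y z
  have hY : Y = fun _ => y := funext fun _ => Subsingleton.elim _ _
  rw [hY, prob_comp_injective p (X := Z) (fun v => (y, v)) (fun a b h => by simpa using h),
    prob_comp_injective p (X := fun ω => (X ω, Z ω)) (fun v : α × γ => (v.1, y, v.2))
      (fun a b h => by simpa [Prod.ext_iff] using h) (x, z)]

/-! ### Conditional independence -/

/-- If the joint law of `(X, Y, Z)` is, in its first argument, proportional to a probability
weight `w`, then `X` and `Y` are independent given `Z`. -/
theorem condMutualInfo_eq_zero_of_proportional [Fintype α] [Fintype β] [Fintype γ]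
    (X : Ω → α) (Y : Ω → β) (Z : Ω → γ) (w : α → ℝ) (hw : ∑ x, w x = 1)
    (h : ∀ x x' y z, prob p (fun ω => (X ω, Y ω, Z ω)) (x, y, z) * w x' =
      prob p (fun ω => (X ω, Y ω, Z ω)) (x', y, z) * w x) :
    condMutualInfo p X Y Z = 0 := by
  rw [condMutualInfo_eq_zero_iff]
  have h1 : ∀ x y z, prob p (fun ω => (X ω, Y ω, Z ω)) (x, y, z) =
      prob p (fun ω => (Y ω, Z ω)) (y, z) * w x := fun x y z => by
    rw [prob_skip_fst p X Y Z, Finset.sum_mul, ← mul_one (prob p _ _), ← hw, Finset.mul_sum]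
    exact Finset.sum_congr rfl fun x' _ => h x x' y z
  have h2 : ∀ x z, prob p (fun ω => (X ω, Z ω)) (x, z) = prob p Z z * w x := fun x z => by
    rw [prob_skip_snd p X Y Z, prob_snd p Y Z, Finset.sum_mul]
    exact Finset.sum_congr rfl fun y _ => h1 x y z
  intro x y z
  rw [h1, h2]
  ring

/-- Reweighting along a bijection of the sample space. -/
theorem prob_mul_of_equiv {X : Ω → α} (σ : Ω ≃ Ω) (a a' : α) (r r' : ENNReal)
    (hr : ∀ ω, X ω = a → p ω * r' = p (σ ω) * r) (hX : ∀ ω, X ω = a ↔ X (σ ω) = a') :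
    prob p X a * r'.toReal = prob p X a' * r.toReal := by
  classical
  unfold prob
  rw [← ENNReal.toReal_mul, ← ENNReal.toReal_mul]
  congr 1
  rw [PMF.map_apply, PMF.map_apply, ← ENNReal.tsum_mul_right, ← ENNReal.tsum_mul_right,
    ← σ.tsum_eq (fun ω => (if a' = X ω then p ω else 0) * r)]
  refine tsum_congr fun ω => ?_
  by_cases h : X ω = a
  · rw [if_pos h.symm, if_pos ((hX ω).1 h).symm, hr ω h]
  · rw [if_neg fun h' => h h'.symm, if_neg fun h' => h ((hX ω).2 h'.symm), zero_mul, zero_mul]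

/-- If translations of `X` over a finite group can be realized by law-preserving bijections that
fix `Y`, then `X` and `Y` are independent. -/
theorem mutualInfo_eq_zero_of_translate [Fintype α] [Fintype β] [AddGroup α]
    (X : Ω → α) (Y : Ω → β)
    (h : ∀ δ : α, ∃ σ : Ω ≃ Ω, (∀ ω, p (σ ω) = p ω) ∧ (∀ ω, X (σ ω) = δ + X ω) ∧
      ∀ ω, Y (σ ω) = Y ω) :
    mutualInfo p X Y = 0 := by
  rw [mutualInfo_eq_condMutualInfo]
  have hc : (Fintype.card α : ℝ) ≠ 0 := by exact_mod_cast Fintype.card_ne_zero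
  refine condMutualInfo_eq_zero_of_proportional p X Y _ (fun _ => (Fintype.card α : ℝ)⁻¹)
    (by simp [hc]) fun x x' y z => ?_
  obtain ⟨σ, h1, h2, h3⟩ := h (x' - x)
  congr 1
  have := prob_mul_of_equiv p (X := fun ω => (X ω, Y ω, ())) σ (x, y, z) (x', y, z) 1 1
    (fun ω _ => by rw [h1]) (fun ω => by
      simp only [h2, h3, Prod.mk.injEq, and_true]
      refine and_congr_left fun _ => ⟨fun h => by rw [h, sub_add_cancel], fun h => ?_⟩
      exact add_left_cancel (h.trans (sub_add_cancel x' x).symm))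
  simpa using this

/-- If `X` is independent of `(V, Z)`, and `Y` is independent of `(X, V)` given `Z`, then `X` is
independent of `(V, Y)`. -/
theorem mutualInfo_pair_eq_zero {δ : Type*} [Fintype α] [Fintype β] [Fintype γ] [Fintype δ]
    (X : Ω → α) (V : Ω → δ) (Y : Ω → β) (Z : Ω → γ)
    (hX : mutualInfo p X (fun ω => (V ω, Z ω)) = 0)
    (hY : condMutualInfo p (fun ω => (X ω, V ω)) Y Z = 0) :
    mutualInfo p X (fun ω => (V ω, Y ω)) = 0 := by
  rw [mutualInfo_eq_zero_iff] at hX ⊢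
  rw [condMutualInfo_eq_zero_iff] at hY
  -- `X` is in fact independent of the whole of (V, Y, Z): for z of positive mass, condition on z,
  -- factor off `Y`, and use independence of `X` from (V, Z). Summation over z then gives the claim.
  have key : ∀ x v y z, prob p (fun ω => ((X ω, V ω), Y ω, Z ω)) ((x, v), y, z) =
      prob p X x * prob p (fun ω => (V ω, Y ω, Z ω)) (v, y, z) := by
    intro x v y z
    have hX' : ∀ x, prob p (fun ω => ((X ω, V ω), Z ω)) ((x, v), z) =
        prob p X x * prob p (fun ω => (V ω, Z ω)) (v, z) := fun x => by
      rw [← hX]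
      exact prob_comp_injective p (X := fun ω => (X ω, V ω, Z ω))
        (fun t : α × δ × γ => ((t.1, t.2.1), t.2.2))
        (fun a b h => by
          simp only [Prod.mk.injEq] at h
          exact Prod.ext h.1.1 (Prod.ext h.1.2 h.2)) (x, v, z)
    by_cases hz : prob p Z z = 0
    · have h1 : prob p (fun ω => ((X ω, V ω), Y ω, Z ω)) ((x, v), y, z) = 0 := by
        by_contra hne
        obtain ⟨ω, hω, he⟩ := (prob_ne_zero p).1 hne
        simp only [Prod.mk.injEq] at he
        exact (prob_ne_zero p).2 ⟨ω, hω, he.2.2⟩ hz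
      have h2 : prob p (fun ω => (V ω, Y ω, Z ω)) (v, y, z) = 0 := by
        by_contra hne
        obtain ⟨ω, hω, he⟩ := (prob_ne_zero p).1 hne
        simp only [Prod.mk.injEq] at he
        exact (prob_ne_zero p).2 ⟨ω, hω, he.2.2⟩ hz
      rw [h1, h2, mul_zero]
    · have hV : prob p (fun ω => (V ω, Y ω, Z ω)) (v, y, z) * prob p Z z =
          prob p (fun ω => (V ω, Z ω)) (v, z) * prob p (fun ω => (Y ω, Z ω)) (y, z) := by
        have hs : prob p (fun ω => (V ω, Y ω, Z ω)) (v, y, z) =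
            ∑ x, prob p (fun ω => ((X ω, V ω), Y ω, Z ω)) ((x, v), y, z) := by
          rw [prob_skip_fst p X V (fun ω => (Y ω, Z ω))]
          refine Finset.sum_congr rfl fun x _ => ?_
          exact (prob_comp_injective p (X := fun ω => (X ω, V ω, Y ω, Z ω))
            (fun t : α × δ × β × γ => ((t.1, t.2.1), t.2.2))
            (fun a b h => by
              simp only [Prod.mk.injEq] at h
              exact Prod.ext h.1.1 (Prod.ext h.1.2 h.2)) (x, v, y, z)).symm
        rw [hs, Finset.sum_mul]
        simp_rw [hY, hX']
        rw [← Finset.sum_mul, ← Finset.sum_mul, sum_prob, one_mul]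
      refine mul_right_cancel₀ hz ?_
      rw [hY, hX', mul_assoc, mul_assoc, hV]
  intro x ⟨v, y⟩
  rw [prob_fst p (fun ω => (X ω, V ω, Y ω)) Z, prob_fst p (fun ω => (V ω, Y ω)) Z,
    Finset.mul_sum]
  refine Finset.sum_congr rfl fun z _ => ?_
  have e1 : prob p (fun ω => ((X ω, V ω, Y ω), Z ω)) ((x, v, y), z) =
      prob p (fun ω => ((X ω, V ω), Y ω, Z ω)) ((x, v), y, z) :=
    (prob_comp_injective p (X := fun ω => ((X ω, V ω, Y ω), Z ω))
      (fun t : (α × δ × β) × γ => ((t.1.1, t.1.2.1), t.1.2.2, t.2))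
      (fun a b h => by
        simp only [Prod.mk.injEq] at h
        exact Prod.ext (Prod.ext h.1.1 (Prod.ext h.1.2 h.2.1)) h.2.2) ((x, v, y), z)).symm
  have e2 : prob p (fun ω => ((V ω, Y ω), Z ω)) ((v, y), z) =
      prob p (fun ω => (V ω, Y ω, Z ω)) (v, y, z) :=
    (prob_comp_injective p (X := fun ω => ((V ω, Y ω), Z ω))
      (fun t : (δ × β) × γ => (t.1.1, t.1.2, t.2))
      (fun a b h => by
        simp only [Prod.mk.injEq] at h
        exact Prod.ext (Prod.ext h.1 h.2.1) h.2.2) ((v, y), z)).symm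
  rw [e1, e2, key]

theorem mutualInfo_eq_zero_comp [Fintype α] [Fintype β] [Fintype γ] (X : Ω → α) (Y : Ω → β)
    (f : β → γ) (h : mutualInfo p X Y = 0) : mutualInfo p X (fun ω => f (Y ω)) = 0 := by
  classical
  rw [mutualInfo_eq_zero_iff] at h ⊢
  intro x c
  have h1 : prob p (fun ω => (X ω, f (Y ω))) (x, c) =
      ∑ b, if c = f b then prob p (fun ω => (X ω, Y ω)) (x, b) else 0 := by
    rw [prob_comp p (fun ω => (X ω, Y ω)) (fun t => (t.1, f t.2)), Fintype.sum_prod_type,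
      Finset.sum_comm]
    refine Finset.sum_congr rfl fun b _ => ?_
    by_cases hc : c = f b <;> simp [hc]
  rw [h1, prob_comp p Y f, Finset.mul_sum]
  refine Finset.sum_congr rfl fun b _ => ?_
  rw [h]
  split_ifs <;> simp

/-- Data processing. It serves to pass from the contents and queries of the honest servers to their
signals. -/
theorem condMutualInfo_eq_zero_comp {δ : Type*} [Fintype α] [Fintype β] [Fintype γ] [Fintype δ]
    (X : Ω → α) (Y : Ω → β) (Z : Ω → γ) (f : α → γ → δ) (h : condMutualInfo p X Y Z = 0) :
    condMutualInfo p (fun ω => f (X ω) (Z ω)) Y Z = 0 := by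
  classical
  rw [condMutualInfo_eq_zero_iff] at h ⊢
  intro d y z
  have h1 : prob p (fun ω => (f (X ω) (Z ω), Y ω, Z ω)) (d, y, z) =
      ∑ x, if d = f x z then prob p (fun ω => (X ω, Y ω, Z ω)) (x, y, z) else 0 := by
    rw [prob_comp p (fun ω => (X ω, Y ω, Z ω)) (fun t => (f t.1 t.2.2, t.2.1, t.2.2)),
      Fintype.sum_prod_type]
    refine Finset.sum_congr rfl fun x _ => ?_
    rw [Finset.sum_eq_single (y, z)]
    · simp
    · rintro ⟨y', z'⟩ _ hne
      rw [if_neg]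
      intro he
      simp only [Prod.mk.injEq] at he
      exact hne (by rw [he.2.1, he.2.2])
    · simp
  have h2 : prob p (fun ω => (f (X ω) (Z ω), Z ω)) (d, z) =
      ∑ x, if d = f x z then prob p (fun ω => (X ω, Z ω)) (x, z) else 0 := by
    rw [prob_comp p (fun ω => (X ω, Z ω)) (fun t => (f t.1 t.2, t.2)),
      Fintype.sum_prod_type]
    refine Finset.sum_congr rfl fun x _ => ?_
    rw [Finset.sum_eq_single z]
    · simp
    · rintro z' _ hne
      rw [if_neg]
      intro he
      simp only [Prod.mk.injEq] at he
      exact hne he.2.symm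
    · simp
  rw [h1, h2, Finset.sum_mul, Finset.sum_mul]
  refine Finset.sum_congr rfl fun x _ => ?_
  split_ifs
  · exact h x y z
  · simp

end Prob

/-! ### The law of a scheme -/

theorem productLaw_apply {n : ℕ} {α : Type*} [Fintype α] (p : Fin n → PMF α) (x : Fin n → α) :
    productLaw p x = ∏ k, p k (x k) := rfl

theorem exists_mem_support_productLaw {n : ℕ} {α : Type*} [Fintype α] (p : Fin n → PMF α) :
    ∃ x, productLaw p x ≠ 0 := (productLaw p).support_nonempty

/-- Comparison of cardinalities, which are powers of |F|. This replaces entropy inequalities in the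
converse. -/
theorem le_of_injective_words {F : Type*} [Fintype F] [Nontrivial F] {ι : Type*} [Fintype ι] {a : ℕ} {b : ι → ℕ}
    (f : (Fin a → F) → ((i : ι) → Fin (b i) → F)) (hf : Function.Injective f) :
    a ≤ ∑ i, b i := by
  classical
  have := Fintype.card_le_of_injective f hf
  simp only [Fintype.card_pi, Finset.prod_const, Finset.card_univ, Fintype.card_fin] at this
  rw [Finset.prod_pow_eq_pow_sum] at this
  exact (Nat.pow_le_pow_iff_right Fintype.one_lt_card).1 this

namespace Scheme

variable {F : Type u} {N K H : ℕ} [Field F] [Fintype F] (S : Scheme F N K H)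

theorem law_apply (D : Fin K → PMF (Fin N → F)) (ω : S.Sample) :
    S.law D ω = (Fintype.card (Files F N S.B) : ENNReal)⁻¹ *
      (S.uLaw ω.2.1 * (productLaw S.pLaw ω.2.2.1 * productLaw D ω.2.2.2)) := by
  classical
  obtain ⟨W, U, P, d⟩ := ω
  unfold law
  rw [PMF.bind_apply, tsum_eq_single W, PMF.uniformOfFintype_apply, PMF.bind_apply,
    tsum_eq_single U, PMF.bind_apply, tsum_eq_single P, PMF.map_apply, tsum_eq_single d]
  · simp
  · intro d' h
    rw [if_neg]
    intro h'
    simp only [Prod.mk.injEq, true_and] at h'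
    exact h h'.symm
  · intro P' h
    rw [PMF.map_apply, ENNReal.tsum_eq_zero.2, mul_zero]
    intro d'
    rw [if_neg]
    intro h'
    simp only [Prod.mk.injEq, true_and] at h'
    exact h h'.1.symm
  · intro U' h
    rw [mul_eq_zero]
    right
    by_contra h0
    rw [← Ne, ← PMF.mem_support_iff] at h0
    simp only [PMF.mem_support_bind_iff, PMF.mem_support_map_iff, Prod.mk.injEq] at h0
    obtain ⟨_, _, _, _, h1⟩ := h0
    exact h h1.2.1
  · intro W' h
    rw [mul_eq_zero]
    right
    by_contra h0
    rw [← Ne, ← PMF.mem_support_iff] at h0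
    simp only [PMF.mem_support_bind_iff, PMF.mem_support_map_iff, Prod.mk.injEq] at h0
    obtain ⟨_, _, _, _, _, _, h1⟩ := h0
    exact h h1.1

theorem mem_support_law (D : Fin K → PMF (Fin N → F)) (ω : S.Sample) :
    ω ∈ (S.law D).support ↔
      S.uLaw ω.2.1 ≠ 0 ∧ productLaw S.pLaw ω.2.2.1 ≠ 0 ∧ productLaw D ω.2.2.2 ≠ 0 := by
  rw [PMF.mem_support_iff, law_apply]
  simp [mul_eq_zero, not_or, ENNReal.inv_eq_zero]

/-! ### Consequences of validity without adversarial servers -/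

/-- The converse uses recovery and decoding only with no adversary, through this trivial
falsification. -/
theorem isFalseContent_empty (D : Fin K → PMF (Fin N → F)) :
    S.IsFalseContent D ∅ ((S.law D).map fun ω => (ω, default)) where
  marginal := by rw [PMF.map_comp]; exact PMF.map_id _
  noInfo := condMutualInfo_const_middle _ _ _ _

theorem isFalseSignal_empty (D : Fin K → PMF (Fin N → F)) :
    S.IsFalseSignal D ∅ ((S.law D).map fun ω => (ω, default)) where
  marginal := by rw [PMF.map_comp]; exact PMF.map_id _
  noInfo := condMutualInfo_const_middle _ _ _ _

variable {S} {A I J : ℕ}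

theorem IsValid.files_eq_of_contents (hS : S.IsValid A I J) (D : Fin K → PMF (Fin N → F))
    {𝒥 : Finset (Fin H)} (h𝒥 : 𝒥.card = J) {ω ω' : S.Sample}
    (hω : ω ∈ (S.law D).support) (hω' : ω' ∈ (S.law D).support)
    (h : ∀ j ∈ 𝒥, S.content ω j = S.content ω' j) : S.files ω = S.files ω' := by
  have := hS.robustRecovery D ∅ 𝒥 (by simp) h𝒥 _ (S.isFalseContent_empty D)
  rw [condEntropy_eq_zero_iff] at this
  refine this (ω, default) ((PMF.mem_support_map_iff _ _ _).2 ⟨ω, hω, rfl⟩) (ω', default)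
    ((PMF.mem_support_map_iff _ _ _).2 ⟨ω', hω', rfl⟩) ?_
  refine Prod.ext (funext fun j => h j.1 (Finset.mem_sdiff.1 j.2).1) (funext fun j => ?_)
  exact absurd (Finset.mem_inter.1 j.2).2 (Finset.notMem_empty _)

theorem IsValid.wanted_eq_of_signals (hS : S.IsValid A I J) (D : Fin K → PMF (Fin N → F))
    {𝒥 : Finset (Fin H)} (h𝒥 : 𝒥.card = J) {ω ω' : S.Sample}
    (hω : ω ∈ (S.law D).support) (hω' : ω' ∈ (S.law D).support)
    (h : ∀ j ∈ 𝒥, S.serverSignal ω j = S.serverSignal ω' j) (k : Fin K)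
    (hd : S.demand ω k = S.demand ω' k) (hC : S.userCache ω k = S.userCache ω' k) :
    S.wanted k ω = S.wanted k ω' := by
  have := hS.robustDecoding D ∅ 𝒥 (by simp) h𝒥 _ (S.isFalseSignal_empty D) k
  rw [condEntropy_eq_zero_iff] at this
  refine this (ω, default) ((PMF.mem_support_map_iff _ _ _).2 ⟨ω, hω, rfl⟩) (ω', default)
    ((PMF.mem_support_map_iff _ _ _).2 ⟨ω', hω', rfl⟩) ?_
  refine Prod.ext (funext fun j => h j.1 (Finset.mem_sdiff.1 j.2).1)
    (Prod.ext (funext fun j => ?_) (Prod.ext hd hC))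
  exact absurd (Finset.mem_inter.1 j.2).2 (Finset.notMem_empty _)

/-- By server security, one value of the contents of `I` servers is compatible with all files. -/
theorem IsValid.exists_common_contents (hS : S.IsValid A I J) {ℐ : Finset (Fin H)}
    (hℐ : ℐ.card = I) : ∃ u : Files F N S.B → S.UAlpha, (∀ W, S.uLaw (u W) ≠ 0) ∧
      ∀ W W' : Files F N S.B, ∀ h ∈ ℐ, S.store h W (u W) = S.store h W' (u W') := by
  let D : Fin K → PMF (Fin N → F) := fun _ => PMF.uniformOfFintype _
  obtain ⟨ω₀, hω₀⟩ := (S.law D).support_nonempty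
  have hind := (mutualInfo_eq_zero_iff (S.law D) S.files (S.contentsOn ℐ)).1
    (hS.serverSecurity D ℐ hℐ)
  -- Under independence the mass of a pair is the product of two positive masses, so every `W`
  -- occurs together with the contents seen at `ω₀`.
  have key : ∀ W : Files F N S.B, ∃ U, S.uLaw U ≠ 0 ∧
      ∀ h ∈ ℐ, S.store h W U = S.content ω₀ h := by
    intro W
    have h1 : prob (S.law D) S.files W ≠ 0 :=
      (prob_ne_zero _).2 ⟨(W, ω₀.2), by
        rw [mem_support_law] at hω₀ ⊢
        exact hω₀, rfl⟩
    have h2 : prob (S.law D) (S.contentsOn ℐ) (S.contentsOn ℐ ω₀) ≠ 0 :=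
      (prob_ne_zero _).2 ⟨ω₀, hω₀, rfl⟩
    have h3 := mul_ne_zero h1 h2
    rw [← hind] at h3
    obtain ⟨ω, hω, he⟩ := (prob_ne_zero _).1 h3
    simp only [Prod.mk.injEq] at he
    refine ⟨ω.2.1, ((S.mem_support_law D ω).1 hω).1, fun h hh => ?_⟩
    rw [← he.1]
    exact congrFun he.2 ⟨h, hh⟩
  choose u hu hz using key
  exact ⟨u, hu, fun W W' h hh => by rw [hz W h hh, hz W' h hh]⟩

/-! ### Counting bounds -/

/-- The storage bound `N B ≤ (J - I) z`. -/
theorem IsValid.storage_bound (hS : S.IsValid A I J) (hIJ : I ≤ J) (hJH : J ≤ H) :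
    N * S.B ≤ (J - I) * S.storageLen := by
  classical
  obtain ⟨𝒥, h𝒥⟩ := Finset.exists_subset_card_eq (s := (Finset.univ : Finset (Fin H)))
    (n := J) (by simpa using hJH)
  obtain ⟨ℐ, hsub, hℐ⟩ := Finset.exists_subset_card_eq (s := 𝒥) (n := I) (by omega)
  obtain ⟨u, hu, hz⟩ := hS.exists_common_contents hℐ
  let D : Fin K → PMF (Fin N → F) := fun _ => PMF.uniformOfFintype _
  obtain ⟨P, hP⟩ := exists_mem_support_productLaw S.pLaw
  obtain ⟨d, hd⟩ := exists_mem_support_productLaw D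
  let e : (Fin (N * S.B) → F) ≃ Files F N S.B :=
    (finProdFinEquiv.arrowCongr (Equiv.refl F)).symm.trans (Equiv.curry _ _ _)
  let ω : (Fin (N * S.B) → F) → S.Sample := fun w => (e w, u (e w), P, d)
  have hω : ∀ w, ω w ∈ (S.law D).support := fun w => (S.mem_support_law D _).2 ⟨hu _, hP, hd⟩
  -- The randomness `u` freezes the contents on `ℐ`, so those on `𝒥 \ ℐ` alone determine the files.
  have := le_of_injective_words (ι := (𝒥 \ ℐ : Finset (Fin H))) (b := fun _ => S.storageLen)
    (fun w h => S.content (ω w) h) (fun w w' hww' => e.injective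
      (hS.files_eq_of_contents D h𝒥.2 (hω w) (hω w') fun j hj => by
        by_cases hjI : j ∈ ℐ
        · exact hz _ _ j hjI
        · exact congrFun hww' ⟨j, Finset.mem_sdiff.2 ⟨hj, hjI⟩⟩))
  simpa [Finset.card_sdiff_of_subset hsub, h𝒥.2, hℐ] using this

/-- The cut-set bound `s m B ≤ m (J - I) x + s c` from `m` transmissions to `s` users that
demand `s m` different files. -/
theorem IsValid.cutset_bound (hS : S.IsValid A I J) (hIJ : I ≤ J) (hJH : J ≤ H) {s m : ℕ}
    (hsK : s ≤ K) (hsm : m * s ≤ N) :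
    m * s * S.B ≤ m * (J - I) * Finset.univ.sup S.signalLen + s * S.cacheLen := by
  classical
  obtain ⟨𝒥, h𝒥⟩ := Finset.exists_subset_card_eq (s := (Finset.univ : Finset (Fin H)))
    (n := J) (by simpa using hJH)
  obtain ⟨ℐ, hsub, hℐ⟩ := Finset.exists_subset_card_eq (s := 𝒥) (n := I) (by omega)
  obtain ⟨u, hu, hz⟩ := hS.exists_common_contents hℐ
  -- Uniform demands put every demand matrix into the support, so one law serves all `m`
  -- transmissions. The fixed `P` keeps caches the same in all of them.
  let D : Fin K → PMF (Fin N → F) := fun _ => PMF.uniformOfFintype _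
  obtain ⟨P, hP⟩ := exists_mem_support_productLaw S.pLaw
  have hD : ∀ d, productLaw D d ≠ 0 := fun d => by
    rw [productLaw_apply]
    exact Finset.prod_ne_zero_iff.2 fun k _ => by
      simp [D, PMF.uniformOfFintype_apply]
  -- the file demanded by user `k < s` in transmission `i`
  let g : Fin m × Fin s → Fin N := fun x => Fin.castLE hsm (finProdFinEquiv x)
  have hg : Function.Injective g := (Fin.castLE_injective hsm).comp finProdFinEquiv.injective
  let dem : Fin m → Fin K → Fin N → F := fun i k =>
    if h : k.1 < s then Pi.single (g (i, ⟨k.1, h⟩)) 1 else 0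
  let E : (Fin (m * s * S.B) → F) ≃ (Fin m × Fin s → Fin S.B → F) :=
    (finProdFinEquiv.arrowCongr (Equiv.refl F)).symm.trans
      ((Equiv.curry _ _ _).trans (finProdFinEquiv.arrowCongr (Equiv.refl _)).symm)
  -- Only the `m * s` demanded files vary; the others are zero.
  let W : (Fin (m * s * S.B) → F) → Files F N S.B := fun w => Function.extend g (E w) 0
  have hW : ∀ w x, W w (g x) = E w x := fun w x => hg.extend_apply _ _ _
  let ω : Fin m → (Fin (m * s * S.B) → F) → S.Sample := fun i w => (W w, u (W w), P, dem i)
  have hω : ∀ i w, ω i w ∈ (S.law D).support := fun i w =>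
    (S.mem_support_law D _).2 ⟨hu _, hP, hD _⟩
  have hwanted : ∀ i (k : Fin s) w, S.wanted (Fin.castLE hsK k) (ω i w) = E w (i, k) := by
    intro i k w
    have hk : dem i (Fin.castLE hsK k) = Pi.single (g (i, k)) 1 := by
      simp [dem]
    change ∑ n, dem i (Fin.castLE hsK k) n • W w n = _
    rw [hk, Finset.sum_eq_single (g (i, k))]
    · rw [Pi.single_eq_same, one_smul, hW]
    · intro n _ hn
      rw [Pi.single_eq_of_ne hn, zero_smul]
    · simp
  have := le_of_injective_words (F := F) (ι := (Fin m × (𝒥 \ ℐ : Finset (Fin H))) ⊕ Fin s)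
    (b := Sum.elim (fun x => S.signalLen x.2) (fun _ => S.cacheLen))
    (fun w => fun x => match x with
      | Sum.inl x => S.serverSignal (ω x.1 w) x.2
      | Sum.inr k => S.cache (Fin.castLE hsK k) (P (Fin.castLE hsK k)) (u (W w)) (W w))
    (fun w w' hww' => E.injective (funext fun x => by
      rw [← hwanted x.1 x.2 w, ← hwanted x.1 x.2 w']
      refine hS.wanted_eq_of_signals D h𝒥.2 (hω x.1 w) (hω x.1 w') (fun j hj => ?_) _ rfl
        (congrFun hww' (Sum.inr x.2))
      by_cases hjI : j ∈ ℐ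
      · change S.signal j (S.store j (W w) (u (W w))) _ =
          S.signal j (S.store j (W w') (u (W w'))) _
        -- The queries depend only on the fixed `P` and demands, so equal contents give equal
        -- signals.
        rw [hz _ _ j hjI]
        rfl
      · exact congrFun hww' (Sum.inl (x.1, ⟨j, Finset.mem_sdiff.2 ⟨hj, hjI⟩⟩))))
  refine this.trans ?_
  rw [Fintype.sum_sum_type]
  simp only [Sum.elim_inl, Sum.elim_inr, Finset.sum_const, Finset.card_univ, Fintype.card_fin,
    smul_eq_mul]
  refine Nat.add_le_add_right ?_ _
  refine (Finset.sum_le_card_nsmul _ _ (Finset.univ.sup S.signalLen)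
    fun x _ => Finset.le_sup (Finset.mem_univ _)).trans ?_
  have hc : Fintype.card (𝒥 \ ℐ : Finset (Fin H)) = J - I := by
    rw [Fintype.card_coe, Finset.card_sdiff_of_subset hsub, h𝒥.2, hℐ]
  rw [Finset.card_univ, Fintype.card_prod, Fintype.card_fin, hc, smul_eq_mul]

end Scheme

/-! ### Secret sharing by polynomial evaluation -/

section Sharing

variable {E : Type*} [Field E] {I L : ℕ}

/-- The share at `x` of a vector of `I` random and `L` data symbols: the value at `x` of the
polynomial with these coefficients. -/
def share (x : E) : (Fin I ⊕ Fin L → E) →ₗ[E] E :=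
  ∑ j, x ^ (finSumFinEquiv j : ℕ) • LinearMap.proj j

theorem share_apply (x : E) (v : Fin I ⊕ Fin L → E) :
    share x v = ∑ j, x ^ (finSumFinEquiv j : ℕ) * v j := by
  simp [share]

/-- A polynomial of degree below I + L with that many distinct zeros vanishes, by the Vandermonde
matrix. -/
theorem eq_zero_of_share_eq_zero {s : Finset E} (hs : I + L ≤ s.card)
    {v : Fin I ⊕ Fin L → E} (h : ∀ x ∈ s, share x v = 0) : v = 0 := by
  obtain ⟨t, hts, ht⟩ := Finset.exists_subset_card_eq hs
  let f : Fin (I + L) ≃ t := (t.equivFinOfCardEq ht).symm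
  have := Matrix.eq_zero_of_forall_index_sum_mul_pow_eq_zero (f := fun i => (f i : E))
    (v := fun i => v (finSumFinEquiv.symm i))
    (Subtype.val_injective.comp f.injective) (fun j => by
      rw [← h (f j) (hts (f j).2), share_apply, ← finSumFinEquiv.symm.sum_comp]
      exact Finset.sum_congr rfl fun i _ => by simp [mul_comm])
  funext j
  simpa using congrFun this (finSumFinEquiv j)

theorem eq_of_share_eq {s : Finset E} (hs : I + L ≤ s.card)
    {v w : Fin I ⊕ Fin L → E} (h : ∀ x ∈ s, share x v = share x w) : v = w :=
  sub_eq_zero.1 (eq_zero_of_share_eq_zero hs fun x hx => by rw [map_sub, h x hx, sub_self])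

/-- Any data can be completed by random symbols such that `I` given shares vanish. -/
theorem exists_share_eq_zero {s : Finset E} (hs : s.card ≤ I) (w : Fin L → E) :
    ∃ r : Fin I → E, ∀ x ∈ s, share x (Sum.elim r w) = 0 := by
  classical
  -- The random symbols are the coefficients of degree below I, so they must interpolate the
  -- negative of the data part at no more than I points.
  let p := Lagrange.interpolate s id fun x => -∑ l : Fin L, x ^ (I + l : ℕ) * w l
  have hinj : Set.InjOn (id : E → E) s := Function.injective_id.injOn
  have hdeg : p.degree < I :=
    (Lagrange.degree_interpolate_lt _ hinj).trans_le (by exact_mod_cast hs)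
  refine ⟨fun i => p.coeff i, fun x hx => ?_⟩
  have hp : p.eval x = ∑ i : Fin I, x ^ (i : ℕ) * p.coeff i := by
    rw [Polynomial.eval_eq_sum_degreeLTEquiv (Polynomial.mem_degreeLT.2 hdeg)]
    refine Finset.sum_congr rfl fun i _ => ?_
    rw [mul_comm]
    rfl
  have hv : p.eval x = -∑ l : Fin L, x ^ (I + l : ℕ) * w l :=
    Lagrange.eval_interpolate_at_node _ hinj hx
  rw [share_apply, Fintype.sum_sum_type]
  simp only [Sum.elim_inl, Sum.elim_inr, finSumFinEquiv_apply_left, finSumFinEquiv_apply_right,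
    Fin.val_castAdd, Fin.val_natAdd]
  rw [← hp, hv, neg_add_cancel]

end Sharing

/-! ### Index sets -/

section Index

variable {Y : Type} {K : ℕ} {c : Y → ℕ}

/-- Subfiles: pairs of a layer `y` and a set of `c y` users. -/
abbrev Atom (K : ℕ) (c : Y → ℕ) : Type := {a : Y × Finset (Fin K) // a.2.card = c a.1}

/-- Keys: pairs of a layer `y` and a set of `c y + 1` users. -/
abbrev KeyAtom (K : ℕ) (c : Y → ℕ) : Type := {s : Y × Finset (Fin K) // s.2.card = c s.1 + 1}

/-- Removal of a user from the set of a key. -/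
def KeyAtom.erase (s : KeyAtom K c) (k : s.1.2) : Atom K c :=
  ⟨(s.1.1, s.1.2.erase k), by rw [Finset.card_erase_of_mem k.2, s.2, Nat.add_sub_cancel]⟩

/-- Addition of a user to the set of a subfile. -/
def Atom.insert (a : Atom K c) (k : Fin K) (hk : k ∉ a.1.2) : KeyAtom K c :=
  ⟨(a.1.1, Insert.insert k a.1.2), by rw [Finset.card_insert_of_notMem hk, a.2]⟩

theorem Atom.mem_insert_self (a : Atom K c) (k : Fin K) (hk : k ∉ a.1.2) :
    k ∈ (a.insert k hk).1.2 := Finset.mem_insert_self k a.1.2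

theorem Atom.erase_insert (a : Atom K c) (k : Fin K) (hk : k ∉ a.1.2) :
    (a.insert k hk).erase ⟨k, a.mem_insert_self k hk⟩ = a :=
  Subtype.ext (Prod.ext rfl (Finset.erase_insert hk))

theorem KeyAtom.mem_erase (s : KeyAtom K c) (j k : s.1.2) (h : j ≠ k) :
    j.1 ∈ (s.erase k).1.2 :=
  Finset.mem_erase.2 ⟨fun h' => h (Subtype.ext h'), j.2⟩

/-- Packets stored at a server: shares of subfiles and of keys. -/
abbrev StoreIdx (N K : ℕ) (c : Y → ℕ) : Type := (Fin N × Atom K c) ⊕ KeyAtom K c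

/-- Random packets: those that blind the subfiles, and the keys. -/
abbrev RandIdx (N K I L : ℕ) (c : Y → ℕ) : Type :=
  (Fin N × Atom K c × Fin I) ⊕ (KeyAtom K c × (Fin I ⊕ Fin L))

/-- Packets cached at user `k`. -/
abbrev CacheIdx (N L : ℕ) (c : Y → ℕ) (k : Fin K) : Type :=
  ({a : Atom K c // k ∈ a.1.2} × (Fin N × Fin L)) ⊕ ({a : Atom K c // k ∉ a.1.2} × Fin L)

end Index

/-! ### Storage, caching and delivery over a field extension -/

section Symbols

variable {Y : Type} {F E : Type u} [Field F] [Field E] [Algebra F E] {N K I L : ℕ} {c : Y → ℕ}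

/-- The vector shared for a subfile: its blinding packets and its `L` data packets. -/
def fileVec (W : Fin N → Atom K c × Fin L → E) (U : RandIdx N K I L c → E) (n : Fin N)
    (a : Atom K c) : Fin I ⊕ Fin L → E :=
  Sum.elim (fun i => U (Sum.inl (n, a, i))) (fun l => W n (a, l))

/-- The vector shared for a key. -/
def keyVec (U : RandIdx N K I L c → E) (s : KeyAtom K c) : Fin I ⊕ Fin L → E :=
  fun j => U (Sum.inr (s, j))

/-- The content of the server with evaluation point `x`. -/
def shares (x : E) (W : Fin N → Atom K c × Fin L → E) (U : RandIdx N K I L c → E) :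
    StoreIdx N K c → E :=
  Sum.elim (fun i => share x (fileVec W U i.1 i.2)) (fun s => share x (keyVec U s))

/-- The packets computed from the content `Z` of a server. -/
def transmit (Q : Fin K → Fin N → F) (Z : StoreIdx N K c → E) (s : KeyAtom K c) : E :=
  Z (Sum.inr s) + ∑ k : s.1.2, ∑ n, Q k n • Z (Sum.inl (n, s.erase k))

/-- The combination of subfiles demanded in the set of `s`. -/
def demandVec (Q : Fin K → Fin N → F) (V : Fin N → Atom K c → Fin I ⊕ Fin L → E)
    (s : KeyAtom K c) : Fin I ⊕ Fin L → E :=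
  ∑ k : s.1.2, ∑ n, Q k n • V n (s.erase k)

/-- The packets cached at user `k` with private vector `p`. -/
def cached (k : Fin K) (p : Fin N → F) (U : RandIdx N K I L c → E)
    (W : Fin N → Atom K c × Fin L → E) : CacheIdx N L c k → E :=
  Sum.elim (fun i => W i.2.1 (i.1.1, i.2.2))
    (fun i => U (Sum.inr (i.1.1.insert k i.1.2, Sum.inr i.2)) + ∑ n, p n • W n (i.1.1, i.2))

/-- Sharing is linear and all vectors at a server use the same point, so a server computes a share
of the masked combination without knowing it. -/
theorem transmit_shares (Q : Fin K → Fin N → F) (x : E) (W : Fin N → Atom K c × Fin L → E)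
    (U : RandIdx N K I L c → E) (s : KeyAtom K c) :
    transmit Q (shares x W U) s = share x (keyVec U s + demandVec Q (fileVec W U) s) := by
  simp only [transmit, shares, Sum.elim_inl, Sum.elim_inr, demandVec, map_add, map_sum,
    LinearMap.map_smul_of_tower]

/-- A user with unchanged cache that receives an unchanged combination decodes the same file
combination. -/
theorem decode_eq {k : Fin K} {p d : Fin N → F} {Q : Fin K → Fin N → F} (hQ : Q k = d + p)
    {U U' : RandIdx N K I L c → E} {W W' : Fin N → Atom K c × Fin L → E}
    (hC : cached k p U W = cached k p U' W')
    (hX : ∀ s, keyVec U s + demandVec Q (fileVec W U) s =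
      keyVec U' s + demandVec Q (fileVec W' U') s) :
    ∑ n, d n • W n = ∑ n, d n • W' n := by
  have hmem : ∀ n (a : Atom K c) l, k ∈ a.1.2 → W n (a, l) = W' n (a, l) := fun n a l h =>
    congrFun hC (Sum.inl (⟨a, h⟩, n, l))
  funext ⟨a, l⟩
  simp only [Finset.sum_apply, Pi.smul_apply]
  by_cases hk : k ∈ a.1.2
  · exact Finset.sum_congr rfl fun n _ => by rw [hmem n a l hk]
  -- A subfile that is not cached is delivered through the set obtained by adding `k`; the matching
  -- cached packet contains the same key.
  · have h1 := congrFun (hX (a.insert k hk)) (Sum.inr l)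
    have h2 := congrFun hC (Sum.inr (⟨a, hk⟩, l))
    have hks := a.mem_insert_self k hk
    simp only [cached, Sum.elim_inr] at h2
    simp only [Pi.add_apply, keyVec, demandVec, Finset.sum_apply, Pi.smul_apply, fileVec,
      Sum.elim_inr] at h1
    rw [← Finset.add_sum_erase _ _ (Finset.mem_univ (⟨k, hks⟩ : (a.insert k hk).1.2)),
      ← Finset.add_sum_erase _ _ (Finset.mem_univ (⟨k, hks⟩ : (a.insert k hk).1.2)),
      a.erase_insert k hk] at h1
    -- The terms of the other users involve sets that still contain `k`, and these packets are
    -- cached.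
    have h3 : ∑ j ∈ Finset.univ.erase (⟨k, hks⟩ : (a.insert k hk).1.2), ∑ n,
        Q j n • W n ((a.insert k hk).erase j, l) =
        ∑ j ∈ Finset.univ.erase (⟨k, hks⟩ : (a.insert k hk).1.2), ∑ n,
        Q j n • W' n ((a.insert k hk).erase j, l) :=
      Finset.sum_congr rfl fun j hj => Finset.sum_congr rfl fun n _ => by
        rw [hmem n _ l ((a.insert k hk).mem_erase ⟨k, hks⟩ j (Finset.ne_of_mem_erase hj).symm)]
    rw [h3] at h1
    simp only [hQ, Pi.add_apply, add_smul, Finset.sum_add_distrib] at h1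
    linear_combination h1 - h2

end Symbols

/-! ### Words over the base field -/

section Words

theorem append_inj {F : Type*} {a b : ℕ} {u u' : Fin a → F} {v v' : Fin b → F}
    (h : Fin.append u v = Fin.append u' v') : u = u' ∧ v = v' := by
  constructor
  · funext i
    simpa using congrFun h (Fin.castAdd b i)
  · funext i
    simpa using congrFun h (Fin.natAdd a i)
variable {F E : Type u} [Field F] [Field E] [Algebra F E] {m : ℕ}

/-- Families of symbols of the extension field as words over the base field. -/
def word {ι : Type} {r : ℕ} (e : E ≃ₗ[F] (Fin m → F)) (f : Fin r ≃ ι) :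
    (ι → E) ≃ₗ[F] (Fin (r * m) → F) :=
  (LinearEquiv.funCongrLeft F E f).trans <|
    (LinearEquiv.piCongrRight fun _ => e).trans <|
      (LinearEquiv.curry F F (Fin r) (Fin m)).symm.trans
        (LinearEquiv.funCongrLeft F F finProdFinEquiv.symm)

theorem word_apply {ι : Type} {r : ℕ} (e : E ≃ₗ[F] (Fin m → F)) (f : Fin r ≃ ι) (v : ι → E)
    (i : Fin r) (x : Fin m) : word e f v (finProdFinEquiv (i, x)) = e (v (f i)) x := by
  simp only [word, LinearEquiv.trans_apply, LinearEquiv.funCongrLeft_apply, LinearMap.funLeft_apply,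
    Equiv.symm_apply_apply]
  rfl

theorem word_packet {ι : Type} {r : ℕ} (e : E ≃ₗ[F] (Fin m → F)) (f : Fin r ≃ ι) (v : ι → E)
    (i : Fin r) : (fun x => word e f v (finProdFinEquiv (i, x))) = e (v (f i)) :=
  funext fun x => word_apply e f v i x

theorem coord_unword {ι : Type} {r : ℕ} (e : E ≃ₗ[F] (Fin m → F)) (f : Fin r ≃ ι)
    (Z : Fin (r * m) → F) (i : Fin r) :
    e ((word e f).symm Z (f i)) = fun x => Z (finProdFinEquiv (i, x)) := by
  rw [← word_packet e f, LinearEquiv.apply_symm_apply]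

end Words

/-! ### The coded scheme: definition, recovery, security and privacy -/

section Construction

variable {Y : Type} [Fintype Y] {F E : Type u} [Field F] [Field E] [Algebra F E]

variable (E) in
/-- The parameters of the coded scheme: levels `c` of the layers, evaluation points of the
servers, coordinates of the extension field, and enumerations of the caches. -/
structure CodedData (F : Type u) [Field F] [Algebra F E] (N K H L : ℕ) (c : Y → ℕ) where
  m : ℕ
  coord : E ≃ₗ[F] (Fin m → F)
  point : Fin H → E
  point_injective : Function.Injective point
  cacheCount : ℕ
  cacheEquiv : (k : Fin K) → Fin cacheCount ≃ CacheIdx N L c k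
  pos : 0 < Fintype.card (Atom K c × Fin L) * m

namespace CodedData

variable {N K H L : ℕ} {c : Y → ℕ} (I : ℕ) (G : CodedData E F N K H L c)

/-- The symbols of a file as packets. -/
def fileWord : (Atom K c × Fin L → E) ≃ₗ[F] (Fin (Fintype.card (Atom K c × Fin L) * G.m) → F) :=
  word G.coord (Fintype.equivFin _).symm

/-- The packets of the files. -/
def packets (W : Files F N (Fintype.card (Atom K c × Fin L) * G.m)) :
    Fin N → Atom K c × Fin L → E := fun n => G.fileWord.symm (W n)

theorem packets_add (W W' : Files F N (Fintype.card (Atom K c × Fin L) * G.m)) :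
    G.packets (W + W') = G.packets W + G.packets W' := by
  funext n
  simp [packets]

theorem coord_packets (W : Files F N (Fintype.card (Atom K c × Fin L) * G.m)) (n : Fin N) (j) :
    G.coord (G.packets W n ((Fintype.equivFin _).symm j)) =
      fun x => W n (finProdFinEquiv (j, x)) := by
  rw [← word_packet G.coord (Fintype.equivFin (Atom K c × Fin L)).symm]
  funext x
  exact congrFun (G.fileWord.apply_symm_apply (W n)) _

theorem card_image_point (s : Finset (Fin H)) [DecidableEq E] :
    (s.image G.point).card = s.card :=
  Finset.card_image_of_injective _ G.point_injective

variable [Fintype F] [Fintype E]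

instance randomnessFintype : Fintype (RandIdx N K I L c → E) := Fintype.ofFinite _

/-- The coded scheme. -/
abbrev scheme : Scheme F N K H where
  B := Fintype.card (Atom K c × Fin L) * G.m
  B_pos := G.pos
  UAlpha := RandIdx N K I L c → E
  uLaw := PMF.uniformOfFintype _
  PAlpha := Fin N → F
  pLaw := fun _ => PMF.uniformOfFintype _
  storageLen := Fintype.card (StoreIdx N K c) * G.m
  cacheLen := N + G.cacheCount * G.m
  queryLen := fun _ _ => N
  signalLen := fun _ => K * N + Fintype.card (KeyAtom K c) * G.m
  store := fun h W U => word G.coord (Fintype.equivFin _).symm (shares (G.point h) (G.packets W) U)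
  cache := fun k P U W => Fin.append P (word G.coord (G.cacheEquiv k) (cached k P U (G.packets W)))
  query := fun _ _ d P => d + P
  signal := fun _ Z Q =>
    Fin.append (fun x => Q (finProdFinEquiv.symm x).1 (finProdFinEquiv.symm x).2)
      (word G.coord (Fintype.equivFin _).symm
        (transmit Q ((word G.coord (Fintype.equivFin (StoreIdx N K c)).symm).symm Z)))

theorem content_eq (ω : (G.scheme I).Sample) (h : Fin H) :
    (G.scheme I).content ω h = word G.coord (Fintype.equivFin _).symm
      (shares (G.point h) (G.packets ω.1) ω.2.1) := rfl

theorem userCache_eq (ω : (G.scheme I).Sample) (k : Fin K) :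
    (G.scheme I).userCache ω k = Fin.append (ω.2.2.1 k)
      (word G.coord (G.cacheEquiv k) (cached k (ω.2.2.1 k) ω.2.1 (G.packets ω.1))) := rfl

/-- The vectors behind the signals. -/
def masked (ω : (G.scheme I).Sample) (s : KeyAtom K c) : Fin I ⊕ Fin L → E :=
  keyVec ω.2.1 s + demandVec (ω.2.2.2 + ω.2.2.1) (fileVec (G.packets ω.1) ω.2.1) s

theorem serverSignal_eq (ω : (G.scheme I).Sample) (h : Fin H) :
    (G.scheme I).serverSignal ω h =
      Fin.append (fun x => (ω.2.2.2 + ω.2.2.1) (finProdFinEquiv.symm x).1 (finProdFinEquiv.symm x).2)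
        (word G.coord (Fintype.equivFin _).symm fun s => share (G.point h) (G.masked I ω s)) := by
  change Fin.append (fun x => (ω.2.2.2 + ω.2.2.1) (finProdFinEquiv.symm x).1
    (finProdFinEquiv.symm x).2) (word G.coord (Fintype.equivFin _).symm
    (transmit (ω.2.2.2 + ω.2.2.1) ((word G.coord (Fintype.equivFin (StoreIdx N K c)).symm).symm
      (word G.coord (Fintype.equivFin _).symm (shares (G.point h) (G.packets ω.1) ω.2.1))))) = _
  rw [LinearEquiv.symm_apply_apply]
  congr 2
  funext s
  exact transmit_shares _ _ _ _ _

/-! ### Recovery -/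

theorem files_eq_of_content {s : Finset (Fin H)} (hs : I + L ≤ s.card)
    {ω ω' : (G.scheme I).Sample}
    (h : ∀ j ∈ s, (G.scheme I).content ω j = (G.scheme I).content ω' j) : ω.1 = ω'.1 := by
  classical
  have key : G.packets ω.1 = G.packets ω'.1 := by
    funext n ⟨a, l⟩
    have hv : fileVec (G.packets ω.1) ω.2.1 n a = fileVec (G.packets ω'.1) ω'.2.1 n a := by
      refine eq_of_share_eq (s := s.image G.point) (by rwa [card_image_point]) fun x hx => ?_
      obtain ⟨j, hj, rfl⟩ := Finset.mem_image.1 hx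
      have := h j hj
      rw [content_eq, content_eq] at this
      exact congrFun ((word G.coord _).injective this) (Sum.inl (n, a))
    exact congrFun hv (Sum.inr l)
  funext n
  exact G.fileWord.symm.injective (congrFun key n)

theorem wanted_eq_of_signal {s : Finset (Fin H)} (hs : I + L ≤ s.card) (hs0 : s.Nonempty)
    {ω ω' : (G.scheme I).Sample}
    (h : ∀ j ∈ s, (G.scheme I).serverSignal ω j = (G.scheme I).serverSignal ω' j) (k : Fin K)
    (hd : (G.scheme I).demand ω k = (G.scheme I).demand ω' k)
    (hC : (G.scheme I).userCache ω k = (G.scheme I).userCache ω' k) :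
    (G.scheme I).wanted k ω = (G.scheme I).wanted k ω' := by
  classical
  have hsig : ∀ j ∈ s, ω.2.2.2 + ω.2.2.1 = ω'.2.2.2 + ω'.2.2.1 ∧
      (fun s => share (G.point j) (G.masked I ω s)) =
        fun s => share (G.point j) (G.masked I ω' s) := by
    intro j hj
    have := h j hj
    rw [serverSignal_eq, serverSignal_eq] at this
    obtain ⟨h1, h2⟩ := append_inj this
    refine ⟨?_, (word G.coord _).injective h2⟩
    funext k n
    simpa using congrFun h1 (finProdFinEquiv (k, n))
  -- All queries can be read from the header of any one signal.
  have hQ : ω.2.2.2 + ω.2.2.1 = ω'.2.2.2 + ω'.2.2.1 := by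
    obtain ⟨j, hj⟩ := hs0
    exact (hsig j hj).1
  have hmask : ∀ t, G.masked I ω t = G.masked I ω' t := fun t => by
    refine eq_of_share_eq (s := s.image G.point) (by rwa [card_image_point]) fun x hx => ?_
    obtain ⟨j, hj, rfl⟩ := Finset.mem_image.1 hx
    exact congrFun (hsig j hj).2 t
  rw [userCache_eq, userCache_eq] at hC
  obtain ⟨hP, hC⟩ := append_inj hC
  have hd' : ω.2.2.2 k = ω'.2.2.2 k := hd
  rw [← hP] at hC
  have := decode_eq (d := ω.2.2.2 k) (Q := ω.2.2.2 + ω.2.2.1) rfl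
    ((word G.coord (G.cacheEquiv k)).injective hC) (fun t => by
      have := hmask t
      rw [masked, masked, ← hQ] at this
      exact this)
  have hw : ∀ ω : (G.scheme I).Sample, (G.scheme I).wanted k ω =
      G.fileWord (∑ n, ω.2.2.2 k n • G.packets ω.1 n) := fun ω => by
    rw [map_sum]
    refine Finset.sum_congr rfl fun n _ => ?_
    rw [map_smul, packets, LinearEquiv.apply_symm_apply]
    rfl
  rw [hw, hw, ← hd', this]

/-! ### Security -/

/-- The change of the blinding packets that hides a change `V` of the shared vectors. -/
def shift (V : Fin N → Atom K c → Fin I ⊕ Fin L → E) (Q : Fin K → Fin N → F) :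
    RandIdx N K I L c → E :=
  Sum.elim (fun t => V t.1 t.2.1 (Sum.inl t.2.2)) (fun t => -demandVec Q V t.1 t.2)

/-- The bijection of the sample space that adds `δ` to the files and adapts the randomness. -/
def translate (δ : Files F N (Fintype.card (Atom K c × Fin L) * G.m))
    (V : Fin N → Atom K c → Fin I ⊕ Fin L → E) : (G.scheme I).Sample ≃ (G.scheme I).Sample where
  -- The shift depends on the outcome only through the queries, which the map preserves; hence it is
  -- invertible.
  toFun ω := (δ + ω.1, shift I V (ω.2.2.2 + ω.2.2.1) + ω.2.1, ω.2.2.1, ω.2.2.2)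
  invFun ω := (-δ + ω.1, -shift I V (ω.2.2.2 + ω.2.2.1) + ω.2.1, ω.2.2.1, ω.2.2.2)
  left_inv ω := by
    refine Prod.ext ?_ (Prod.ext ?_ rfl)
    · exact neg_add_cancel_left δ ω.1
    · exact neg_add_cancel_left _ ω.2.1
  right_inv ω := by
    refine Prod.ext ?_ (Prod.ext ?_ rfl)
    · exact add_neg_cancel_left δ ω.1
    · exact add_neg_cancel_left _ ω.2.1

theorem law_translate (D : Fin K → PMF (Fin N → F)) (δ) (V) (ω : (G.scheme I).Sample) :
    (G.scheme I).law D (G.translate I δ V ω) = (G.scheme I).law D ω := by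
  rw [Scheme.law_apply, Scheme.law_apply]
  have : ∀ u u' : RandIdx N K I L c → E,
      (G.scheme I).uLaw u = (G.scheme I).uLaw u' := fun u u' => by
    change PMF.uniformOfFintype _ u = PMF.uniformOfFintype _ u'
    rw [PMF.uniformOfFintype_apply, PMF.uniformOfFintype_apply]
  rw [this (G.translate I δ V ω).2.1 ω.2.1]
  rfl

/-- The files are independent of all signals and queries together with the contents of at most
`I` servers. -/
theorem files_indep (D : Fin K → PMF (Fin N → F)) {𝒜 : Finset (Fin H)} (h𝒜 : 𝒜.card ≤ I) :
    mutualInfo ((G.scheme I).law D) (G.scheme I).files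
      (fun ω => ((G.scheme I).serverSignal ω, (G.scheme I).userQuery ω,
        (G.scheme I).contentsOn 𝒜 ω)) = 0 := by
  classical
  refine mutualInfo_eq_zero_of_translate _ _ _ fun δ => ?_
  -- The blinding packets absorb the change of the data: the resulting change `V` of the shared
  -- vectors has zero shares at the servers in `𝒜`.
  have hr : ∀ (n : Fin N) (a : Atom K c), ∃ r : Fin I → E, ∀ x ∈ 𝒜.image G.point,
      share x (Sum.elim r fun l => G.packets δ n (a, l)) = 0 := fun n a =>
    exists_share_eq_zero (by rwa [card_image_point]) _
  choose r hr using hr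
  let V : Fin N → Atom K c → Fin I ⊕ Fin L → E :=
    fun n a => Sum.elim (r n a) fun l => G.packets δ n (a, l)
  have hfile : ∀ (Q : Fin K → Fin N → F) W U n a, fileVec (G.packets (δ + W)) (shift I V Q + U) n a =
      V n a + fileVec (G.packets W) U n a := fun Q W U n a => by
    funext j
    rcases j with i | l <;> simp [fileVec, shift, V, packets_add]
  have hkey : ∀ (Q : Fin K → Fin N → F) U (s : KeyAtom K c), keyVec (shift I V Q + U) s =
      -demandVec Q V s + keyVec U s := fun Q U s => by
    funext j
    simp [keyVec, shift]
  refine ⟨G.translate I δ V, G.law_translate I D δ V, fun ω => rfl, fun ω => ?_⟩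
  -- The keys move by the negative of the change in the demanded combinations, so every signal is
  -- unchanged. This change of the keys is a combination of values of `V`, so its shares at `𝒜`
  -- vanish too.
  have hmask : G.masked I (G.translate I δ V ω) = G.masked I ω := by
    funext s
    change keyVec (shift I V (ω.2.2.2 + ω.2.2.1) + ω.2.1) s + demandVec (ω.2.2.2 + ω.2.2.1)
      (fileVec (G.packets (δ + ω.1)) (shift I V (ω.2.2.2 + ω.2.2.1) + ω.2.1)) s = _
    have : demandVec (ω.2.2.2 + ω.2.2.1)
        (fileVec (G.packets (δ + ω.1)) (shift I V (ω.2.2.2 + ω.2.2.1) + ω.2.1)) s =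
        demandVec (ω.2.2.2 + ω.2.2.1) V s +
          demandVec (ω.2.2.2 + ω.2.2.1) (fileVec (G.packets ω.1) ω.2.1) s := by
      simp only [demandVec, hfile, smul_add, Finset.sum_add_distrib]
    rw [hkey, this, masked]
    abel
  have hshare : ∀ h ∈ 𝒜, ∀ n a, share (G.point h) (V n a) = 0 := fun h hh n a =>
    hr n a _ (Finset.mem_image_of_mem _ hh)
  refine Prod.ext (funext fun h => ?_) (Prod.ext rfl (funext fun h => ?_))
  · change (G.scheme I).serverSignal _ h = (G.scheme I).serverSignal _ h
    rw [serverSignal_eq, serverSignal_eq, hmask]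
    rfl
  · change (G.scheme I).content _ h = (G.scheme I).content _ h
    rw [content_eq, content_eq]
    congr 1
    change shares (G.point h) (G.packets (δ + ω.1))
      (shift I V (ω.2.2.2 + ω.2.2.1) + ω.2.1) = _
    funext i
    rcases i with ⟨n, a⟩ | s
    · simp only [shares, Sum.elim_inl, hfile, map_add, hshare h h.2, zero_add]
    · simp only [shares, Sum.elim_inr, hkey, map_add, map_neg, demandVec, map_sum,
        LinearMap.map_smul_of_tower, hshare h h.2, smul_zero, Finset.sum_const_zero, neg_zero,
        zero_add]

/-- The bijection of the sample space that adds `v` to the demands and subtracts it from the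
private vectors of the users. -/
def exchange (v : Fin K → Fin N → F) : (G.scheme I).Sample ≃ (G.scheme I).Sample where
  toFun ω := (ω.1, ω.2.1, ω.2.2.1 - v, ω.2.2.2 + v)
  invFun ω := (ω.1, ω.2.1, ω.2.2.1 + v, ω.2.2.2 - v)
  left_inv ω := by
    refine Prod.ext rfl (Prod.ext rfl (Prod.ext ?_ ?_))
    · exact sub_add_cancel ω.2.2.1 v
    · exact add_sub_cancel_right ω.2.2.2 v
  right_inv ω := by
    refine Prod.ext rfl (Prod.ext rfl (Prod.ext ?_ ?_))
    · exact add_sub_cancel_right ω.2.2.1 v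
    · exact sub_add_cancel ω.2.2.2 v

/-- Moving a vector from the uniform masks of the users outside `𝒮` to their demands leaves
everything observed unchanged. It alters the probability only through the law of those demands, so
the joint law is proportional to that law. -/
theorem demand_private (D : Fin K → PMF (Fin N → F)) (𝒮 : Finset (Fin K)) :
    condMutualInfo ((G.scheme I).law D)
      (fun ω => fun k : (𝒮ᶜ : Finset (Fin K)) => (G.scheme I).demand ω k)
      (fun ω => ((fun k : 𝒮 => (G.scheme I).userCache ω k),
        (fun k : 𝒮 => (G.scheme I).demand ω k), (G.scheme I).userQuery ω, (G.scheme I).content ω))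
      (G.scheme I).files = 0 := by
  classical
  refine condMutualInfo_eq_zero_of_proportional _ _ _ _
    (fun x => (∏ k : (𝒮ᶜ : Finset (Fin K)), D k (x k)).toReal) ?_ fun x x' y z => ?_
  · simp_rw [ENNReal.toReal_prod]
    rw [← Fintype.prod_sum fun (k : (𝒮ᶜ : Finset (Fin K))) a => (D k a).toReal]
    refine Finset.prod_eq_one fun k _ => ?_
    rw [← ENNReal.toReal_sum fun a _ => PMF.apply_ne_top _ a]
    have := (D k).tsum_coe
    rw [tsum_fintype] at this
    rw [this, ENNReal.toReal_one]
  · let v : Fin K → Fin N → F := fun k =>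
      if h : k ∈ (𝒮ᶜ : Finset (Fin K)) then x' ⟨k, h⟩ - x ⟨k, h⟩ else 0
    have hv : ∀ k : (𝒮ᶜ : Finset (Fin K)), v k = x' k - x k := fun k => by
      simp only [v, dif_pos k.2]
    have hv0 : ∀ k : 𝒮, v k = 0 := fun k => by
      have : k.1 ∉ (𝒮ᶜ : Finset (Fin K)) := by simp
      simp only [v, dif_neg this]
    refine prob_mul_of_equiv _ (G.exchange I v) _ _ _ _ (fun ω hω => ?_) fun ω => ?_
    · have hx : ∀ k : (𝒮ᶜ : Finset (Fin K)), ω.2.2.2 k = x k := fun k =>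
        congrFun (Prod.mk.inj hω).1 k
      rw [Scheme.law_apply, Scheme.law_apply]
      have hp : productLaw (G.scheme I).pLaw (G.exchange I v ω).2.2.1 =
          productLaw (G.scheme I).pLaw ω.2.2.1 := by
        rw [productLaw_apply, productLaw_apply]
        refine Finset.prod_congr rfl fun k _ => ?_
        change PMF.uniformOfFintype (Fin N → F) _ = PMF.uniformOfFintype (Fin N → F) _
        rw [PMF.uniformOfFintype_apply, PMF.uniformOfFintype_apply]
      have hsplit : ∀ d : Fin K → Fin N → F, productLaw D d =
          (∏ k : 𝒮, D k (d k)) * ∏ k : (𝒮ᶜ : Finset (Fin K)), D k (d k) := fun d => by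
        rw [productLaw_apply, ← Finset.prod_mul_prod_compl 𝒮,
          Finset.prod_coe_sort 𝒮 fun k => D k (d k),
          Finset.prod_coe_sort 𝒮ᶜ fun k => D k (d k)]
      have h1 : (G.exchange I v ω).2.2.2 = ω.2.2.2 + v := rfl
      have h2 : (G.exchange I v ω).2.1 = ω.2.1 := rfl
      rw [hp, h2, hsplit, hsplit, h1]
      simp only [Pi.add_apply, hx, hv, hv0, add_zero, add_sub_cancel]
      ring
    · have hcache : ∀ k : 𝒮, (G.scheme I).userCache (G.exchange I v ω) k =
          (G.scheme I).userCache ω k := fun k => by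
        rw [userCache_eq, userCache_eq]
        change Fin.append (ω.2.2.1 k - v k) (word G.coord (G.cacheEquiv k)
          (cached k (ω.2.2.1 k - v k) ω.2.1 (G.packets ω.1))) = _
        rw [hv0, sub_zero]
      have hdem : ∀ k : 𝒮, (G.scheme I).demand (G.exchange I v ω) k =
          (G.scheme I).demand ω k := fun k => by
        change ω.2.2.2 k + v k = ω.2.2.2 k
        rw [hv0, add_zero]
      have hquery : (G.scheme I).userQuery (G.exchange I v ω) = (G.scheme I).userQuery ω := by
        funext k h
        change ω.2.2.2 k + v k + (ω.2.2.1 k - v k) = ω.2.2.2 k + ω.2.2.1 k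
        abel
      have hfiles : (G.scheme I).files (G.exchange I v ω) = (G.scheme I).files ω := rfl
      have hcontent : (G.scheme I).content (G.exchange I v ω) = (G.scheme I).content ω := rfl
      simp only [hcache, hdem, hquery, hfiles, hcontent, Prod.mk.injEq]
      refine and_congr_left fun _ => ?_
      constructor
      · intro h
        funext k
        change ω.2.2.2 k + v k = x' k
        rw [hv, ← congrFun h k]
        exact add_sub_cancel _ _
      · intro h
        funext k
        have : ω.2.2.2 k + v k = x' k := congrFun h k
        rw [hv] at this
        change ω.2.2.2 k = x k
        exact eq_of_sub_eq_zero (by linear_combination (exp := 1) this)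

end CodedData

end Construction

/-! ### Falsified signals and validity of the coded scheme -/

theorem prob_comp_of_map {Ω Ω' α : Type*} {p : PMF Ω} {ν : PMF Ω'} {π : Ω' → Ω}
    (h : ν.map π = p) (X : Ω → α) : prob ν (fun x => X (π x)) = prob p X := by
  funext a
  unfold prob
  rw [← h, PMF.map_comp]
  rfl

theorem mutualInfo_comp_of_map {Ω Ω' α β : Type*} [Fintype α] [Fintype β] {p : PMF Ω}
    {ν : PMF Ω'} {π : Ω' → Ω} (h : ν.map π = p) (X : Ω → α) (Y : Ω → β) :
    mutualInfo ν (fun x => X (π x)) (fun x => Y (π x)) = mutualInfo p X Y := by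
  simp only [mutualInfo, entropy_eq, prob_comp_of_map h X, prob_comp_of_map h Y,
    prob_comp_of_map h fun ω => (X ω, Y ω)]

/-- Signals stay independent of the files when adversarial servers falsify theirs, if the files are
independent of all signals together with all that the adversarial servers know. -/
theorem Scheme.mutualInfo_false_signals {F : Type u} [Field F] [Fintype F] {N K H : ℕ}
    (S : Scheme F N K H) (D : Fin K → PMF (Fin N → F)) (𝒜 : Finset (Fin H))
    (hind : mutualInfo (S.law D) S.files
      (fun ω => (S.serverSignal ω, S.userQuery ω, S.contentsOn 𝒜 ω)) = 0)
    (ν : PMF (S.Sample × S.SignalsOn 𝒜)) (hν : S.IsFalseSignal D 𝒜 ν) :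
    mutualInfo ν (fun x => S.files x.1) (fun x => (S.signalsOn 𝒜ᶜ x.1, x.2)) = 0 := by
  refine mutualInfo_pair_eq_zero ν _ (fun x => S.signalsOn 𝒜ᶜ x.1) (fun x => x.2)
    (fun x => (S.contentsOn 𝒜 x.1, S.queriesOn 𝒜 x.1)) ?_ ?_
  · rw [mutualInfo_comp_of_map hν.marginal S.files
      (fun ω => (S.signalsOn 𝒜ᶜ ω, S.contentsOn 𝒜 ω, S.queriesOn 𝒜 ω))]
    exact mutualInfo_eq_zero_comp _ _
      (fun ω => (S.serverSignal ω, S.userQuery ω, S.contentsOn 𝒜 ω))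
      (fun t => ((fun h => t.1 h : S.SignalsOn 𝒜ᶜ), t.2.2, fun k (h : 𝒜) => t.2.1 k h)) hind
  · exact condMutualInfo_eq_zero_comp ν
      (fun x => (S.files x.1, S.contentsOn 𝒜ᶜ x.1, S.queriesOn 𝒜ᶜ x.1, S.demand x.1)) _ _
      (fun t _ => (t.1, (fun h => S.signal h (t.2.1 h) fun k => t.2.2.1 k h : S.SignalsOn 𝒜ᶜ)))
      hν.noInfo

namespace CodedData

variable {Y : Type} [Fintype Y] {F E : Type u} [Field F] [Fintype F] [Field E] [Fintype E]
  [Algebra F E] {N K H L : ℕ} {c : Y → ℕ}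

theorem server_secure (G : CodedData E F N K H L c) {I : ℕ} (D : Fin K → PMF (Fin N → F))
    {ℐ : Finset (Fin H)} (hℐ : ℐ.card ≤ I) :
    mutualInfo ((G.scheme I).law D) (G.scheme I).files ((G.scheme I).contentsOn ℐ) = 0 :=
  mutualInfo_eq_zero_comp _ _ (fun ω => ((G.scheme I).serverSignal ω, (G.scheme I).userQuery ω,
        (G.scheme I).contentsOn ℐ ω)) (fun t => t.2.2) (G.files_indep I D hℐ)

/-- Recovery is required for each fixed `𝒜`, so falsified data can be ignored: among J servers at
least J - A ≥ I + L are honest. The bound A ≤ I makes the contents known to the adversaries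
harmless. -/
theorem isValid (G : CodedData E F N K H L c) {A I J : ℕ} (hAI : A ≤ I) (hA : I + L + A ≤ J)
    (hL : 0 < L) : (G.scheme I).IsValid A I J := by
  refine ⟨fun D ℐ hℐ => G.server_secure D hℐ.le, fun D 𝒜 𝒥 h𝒜 h𝒥 ν hν => ?_,
    fun D 𝒜 𝒥 h𝒜 h𝒥 ν hν k => ?_,
    fun D 𝒜 h𝒜 ν hν => ?_, fun D 𝒮 => ?_⟩
  · refine (condEntropy_eq_zero_iff _ _ _).2 fun x _ x' _ h => ?_
    have hc := Finset.le_card_sdiff 𝒜 𝒥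
    exact G.files_eq_of_content I (s := 𝒥 \ 𝒜) (by omega) fun j hj =>
      congrFun (congrArg Prod.fst h) ⟨j, hj⟩
  · refine (condEntropy_eq_zero_iff _ _ _).2 fun x _ x' _ h => ?_
    have hc := Finset.le_card_sdiff 𝒜 𝒥
    have h2 := congrArg Prod.snd h
    exact G.wanted_eq_of_signal I (s := 𝒥 \ 𝒜) (by omega) (Finset.card_pos.1 (by omega))
      (fun j hj => congrFun (congrArg Prod.fst h) ⟨j, hj⟩) k
      (congrArg Prod.fst (congrArg Prod.snd h2)) (congrArg Prod.snd (congrArg Prod.snd h2))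
  · exact (G.scheme I).mutualInfo_false_signals D 𝒜 (G.files_indep I D (h𝒜.trans hAI)) ν hν
  · exact G.demand_private I D 𝒮

end CodedData

/-! ### Packets -/

section Packets

variable {F E : Type u} [Field F] [Field E] [Algebra F E] {m : ℕ}

/-- The action of the extension field on words of `m` symbols. -/
def scalarHom (e : E ≃ₗ[F] (Fin m → F)) : E →ₐ[F] Module.End F (Fin m → F) :=
  (e.conjAlgEquiv F).toAlgHom.comp (Algebra.lmul F E)

theorem scalarHom_apply (e : E ≃ₗ[F] (Fin m → F)) (y z : E) :
    scalarHom e y (e z) = e (y * z) := by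
  simp [scalarHom, LinearEquiv.conjAlgEquiv_apply]

theorem scalarHom_injective (e : E ≃ₗ[F] (Fin m → F)) : Function.Injective (scalarHom e) :=
  fun y y' h => by
    have := congrArg (fun f : Module.End F (Fin m → F) => f (e 1)) h
    simpa [scalarHom_apply] using this

theorem isField_range_scalarHom (e : E ≃ₗ[F] (Fin m → F)) : IsField (scalarHom e).range :=
  (AlgEquiv.ofInjective (scalarHom e) (scalarHom_injective e)).symm.toMulEquiv.isField
    (Field.toIsField E)

/-- An element of the extension field as a coefficient of packets. -/
def scalar (e : E ≃ₗ[F] (Fin m → F)) (y : E) : (scalarHom e).range := ⟨scalarHom e y, y, rfl⟩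

theorem scalar_apply (e : E ≃ₗ[F] (Fin m → F)) (y z : E) :
    (scalar e y).1 (e z) = e (y * z) := scalarHom_apply e y z

theorem linearMap_expand {V : Type} [Fintype V] [DecidableEq V] (g : (V → E) →ₗ[E] E)
    (v : V → E) : g v = ∑ i, g (Pi.single i 1) * v i := by
  conv_lhs => rw [pi_eq_sum_univ' v]
  rw [map_sum]
  refine Finset.sum_congr rfl fun i _ => ?_
  rw [map_smul, smul_eq_mul, mul_comm]

theorem linearMap_expand_packets {V : Type} {r : ℕ} (f : Fin r ≃ V) [DecidableEq V]
    (e : E ≃ₗ[F] (Fin m → F)) (g : (V → E) →ₗ[E] E) (v : V → E) :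
    e (g v) = ∑ i, (scalar e (g (Pi.single (f i) 1))).1 (e (v (f i))) := by
  have : Fintype V := Fintype.ofEquiv _ f
  rw [linearMap_expand g v, map_sum, ← f.sum_comp]
  exact Finset.sum_congr rfl fun i _ => (scalar_apply e _ _).symm

theorem linearMap_expand_files {N : ℕ} {T V : Type} {r t : ℕ} (f : Fin r ≃ V) (f' : Fin t ≃ T)
    [DecidableEq V] [DecidableEq T] (e : E ≃ₗ[F] (Fin m → F))
    (g : ((Fin N → T → E) × (V → E)) →ₗ[E] E) (w : Fin N → T → E) (v : V → E) :
    e (g (w, v)) =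
      (∑ n, ∑ j, (scalar e (g (Pi.single n (Pi.single (f' j) 1), 0))).1 (e (w n (f' j)))) +
        ∑ i, (scalar e (g (0, Pi.single (f i) 1))).1 (e (v (f i))) := by
  have h1 : (w, v) = (∑ n, (Pi.single n (w n), (0 : V → E))) + (0, v) := by
    refine Prod.ext ?_ ?_
    · simp [Prod.fst_sum, Finset.univ_sum_single]
    · simp [Prod.snd_sum]
  rw [h1, map_add, map_sum, map_add, map_sum]
  congr 1
  · exact Finset.sum_congr rfl fun n _ => linearMap_expand_packets f' e
      (g ∘ₗ LinearMap.inl E _ _ ∘ₗ LinearMap.single E (fun _ => T → E) n) (w n)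
  · exact linearMap_expand_packets f e (g ∘ₗ LinearMap.inr E _ _) v

end Packets

/-! ### Linearity of storage, caching and delivery -/

section Linear

variable {Y : Type} {F E : Type u} [Field F] [Field E] [Algebra F E] {N K I L : ℕ} {c : Y → ℕ}

theorem isLinearMap_shares (x : E) (i : StoreIdx N K c) : IsLinearMap E
    fun t : (Fin N → Atom K c × Fin L → E) × (RandIdx N K I L c → E) => shares x t.1 t.2 i := by
  rcases i with ⟨n, a⟩ | s
  · have hadd : ∀ t t' : (Fin N → Atom K c × Fin L → E) × (RandIdx N K I L c → E),
        fileVec (t + t').1 (t + t').2 n a = fileVec t.1 t.2 n a + fileVec t'.1 t'.2 n a :=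
      fun t t' => by funext j; rcases j with j | j <;> rfl
    have hsmul : ∀ (r : E) (t : (Fin N → Atom K c × Fin L → E) × (RandIdx N K I L c → E)),
        fileVec (r • t).1 (r • t).2 n a = r • fileVec t.1 t.2 n a :=
      fun r t => by funext j; rcases j with j | j <;> rfl
    exact ⟨fun t t' => by simp only [shares, Sum.elim_inl, hadd, map_add],
      fun r t => by simp only [shares, Sum.elim_inl, hsmul, map_smul]⟩
  · exact ⟨fun t t' => map_add (share x) (keyVec t.2 s) (keyVec t'.2 s),
      fun r t => map_smul (share x) r (keyVec t.2 s)⟩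

theorem isLinearMap_cached (k : Fin K) (p : Fin N → F) (i : CacheIdx N L c k) : IsLinearMap E
    fun t : (Fin N → Atom K c × Fin L → E) × (RandIdx N K I L c → E) =>
      cached k p t.2 t.1 i := by
  rcases i with i | i
  · exact ⟨fun t t' => rfl, fun r t => rfl⟩
  · refine ⟨fun t t' => ?_, fun r t => ?_⟩
    · simp only [cached, Sum.elim_inr, Prod.fst_add, Prod.snd_add, Pi.add_apply, smul_add,
        Finset.sum_add_distrib]
      ring
    · simp only [cached, Sum.elim_inr, Prod.smul_fst, Prod.smul_snd, Pi.smul_apply, smul_add,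
        Finset.smul_sum, smul_comm r]

theorem isLinearMap_transmit (Q : Fin K → Fin N → F) (s : KeyAtom K c) : IsLinearMap E
    fun Z : StoreIdx N K c → E => transmit Q Z s := by
  refine ⟨fun t t' => ?_, fun r t => ?_⟩
  · simp only [transmit, Pi.add_apply, smul_add, Finset.sum_add_distrib]
    ring
  · simp only [transmit, Pi.smul_apply, smul_add, Finset.smul_sum, smul_comm r]

/-- A packet of a server as a linear function of the packets of files and the random packets. -/
def sharesLin (x : E) (i : StoreIdx N K c) :
    ((Fin N → Atom K c × Fin L → E) × (RandIdx N K I L c → E)) →ₗ[E] E :=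
  IsLinearMap.mk' _ (isLinearMap_shares x i)

/-- A cached packet as a linear function of the packets of files and the random packets. -/
def cachedLin (k : Fin K) (p : Fin N → F) (i : CacheIdx N L c k) :
    ((Fin N → Atom K c × Fin L → E) × (RandIdx N K I L c → E)) →ₗ[E] E :=
  IsLinearMap.mk' _ (isLinearMap_cached k p i)

/-- A transmitted packet as a linear function of the stored packets. -/
def transmitLin (Q : Fin K → Fin N → F) (s : KeyAtom K c) : (StoreIdx N K c → E) →ₗ[E] E :=
  IsLinearMap.mk' _ (isLinearMap_transmit Q s)

end Linear

/-! ### Packetization of the coded scheme -/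

namespace CodedData

variable {Y : Type} [Fintype Y] {F E : Type u} [Field F] [Fintype F] [Field E] [Fintype E]
  [Algebra F E] {N K H L : ℕ} {c : Y → ℕ}

/-- The packets of the coded scheme are the symbols of the extension field. -/
theorem nonempty_packetization (I : ℕ) (G : CodedData E F N K H L c) :
    Nonempty ((G.scheme I).Packetization (Fintype.card (Atom K c × Fin L))) := by
  classical
  exact ⟨{
    b := G.m
    coef := (scalarHom G.coord).range
    coef_isField := isField_range_scalarHom G.coord
    filePos := finProdFinEquiv
    keyCount := Fintype.card (RandIdx N K I L c)
    key := fun U i => G.coord (U ((Fintype.equivFin _).symm i))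
    storeCount := Fintype.card (StoreIdx N K c)
    storePos := finProdFinEquiv
    storeFile := fun h i n j => scalar G.coord
      (sharesLin (I := I) (G.point h) ((Fintype.equivFin _).symm i)
        (Pi.single n (Pi.single ((Fintype.equivFin _).symm j) 1), 0))
    storeKey := fun h i j => scalar G.coord
      (sharesLin (L := L) (G.point h) ((Fintype.equivFin _).symm i)
        (0, Pi.single ((Fintype.equivFin _).symm j) 1))
    store_eq := fun h W U i => by
      refine (word_packet G.coord _ _ i).trans ?_
      refine (linearMap_expand_files (Fintype.equivFin (RandIdx N K I L c)).symm
        (Fintype.equivFin (Atom K c × Fin L)).symm G.coord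
        (sharesLin (G.point h) ((Fintype.equivFin _).symm i))
        (G.packets W) U).trans ?_
      simp only [coord_packets]
    cacheHeaderLen := N
    cacheCount := G.cacheCount
    cachePos := (Equiv.sumCongr (Equiv.refl _) finProdFinEquiv).trans finSumFinEquiv
    cacheHeader := fun _ P => P
    cacheFile := fun k P i n j => scalar G.coord
      (cachedLin (I := I) k P (G.cacheEquiv k i)
        (Pi.single n (Pi.single ((Fintype.equivFin _).symm j) 1), 0))
    cacheKey := fun k P i j => scalar G.coord
      (cachedLin (L := L) k P (G.cacheEquiv k i)
        (0, Pi.single ((Fintype.equivFin _).symm j) 1))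
    cacheHeader_eq := fun k P U W i => by
      exact Fin.append_left _ _ i
    cache_eq := fun k P U W i => by
      have : (fun x => (G.scheme I).cache k P U W
          (((Equiv.sumCongr (Equiv.refl _) finProdFinEquiv).trans finSumFinEquiv)
            (Sum.inr (i, x)))) =
          fun x => word G.coord (G.cacheEquiv k) (cached k P U (G.packets W))
            (finProdFinEquiv (i, x)) := funext fun x => Fin.append_right _ _ _
      refine this.trans ((word_packet G.coord _ _ i).trans ?_)
      refine (linearMap_expand_files (Fintype.equivFin (RandIdx N K I L c)).symm
        (Fintype.equivFin (Atom K c × Fin L)).symm G.coord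
        (cachedLin k P (G.cacheEquiv k i)) (G.packets W) U).trans ?_
      simp only [coord_packets]
    signalHeaderLen := fun _ => K * N
    signalCount := fun _ => Fintype.card (KeyAtom K c)
    signalPos := fun _ => (Equiv.sumCongr (Equiv.refl _) finProdFinEquiv).trans finSumFinEquiv
    signalHeader := fun _ Q x => Q (finProdFinEquiv.symm x).1 (finProdFinEquiv.symm x).2
    signalCoef := fun _ Q i j => scalar G.coord
      (transmitLin Q ((Fintype.equivFin _).symm i)
        (Pi.single ((Fintype.equivFin _).symm j) 1))
    signalHeader_eq := fun h Z Q i => by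
      exact Fin.append_left (fun x => Q (finProdFinEquiv.symm x).1 (finProdFinEquiv.symm x).2)
        (word G.coord (Fintype.equivFin (KeyAtom K c)).symm
          (transmit Q ((word G.coord (Fintype.equivFin (StoreIdx N K c)).symm).symm Z))) i
    signal_eq := fun h Z Q i => by
      have : (fun x => (G.scheme I).signal h Z Q
          (((Equiv.sumCongr (Equiv.refl _) finProdFinEquiv).trans finSumFinEquiv)
            (Sum.inr (i, x)))) =
          fun x => word G.coord (Fintype.equivFin (KeyAtom K c)).symm
            (transmit Q ((word G.coord (Fintype.equivFin (StoreIdx N K c)).symm).symm Z))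
            (finProdFinEquiv (i, x)) := funext fun x => Fin.append_right
              (fun x => Q (finProdFinEquiv.symm x).1 (finProdFinEquiv.symm x).2) _ _
      refine this.trans ((word_packet G.coord _ _ i).trans ?_)
      refine (linearMap_expand_packets (Fintype.equivFin (StoreIdx N K c)).symm G.coord
        (transmitLin Q ((Fintype.equivFin _).symm i)) _).trans ?_
      simp only [coord_unword] }⟩

end CodedData

/-! ### Sizes -/

section Card

variable {Y : Type} [Fintype Y] {K : ℕ} {c : Y → ℕ}

theorem card_atom : Fintype.card (Atom K c) = ∑ y, K.choose (c y) := by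
  rw [Fintype.card_congr
    (Equiv.subtypeProdEquivSigmaSubtype fun y (s : Finset (Fin K)) => s.card = c y),
    Fintype.card_sigma]
  simp

theorem card_keyAtom : Fintype.card (KeyAtom K c) = ∑ y, K.choose (c y + 1) :=
  card_atom (c := fun y => c y + 1)

theorem card_atom_notMem (k : Fin K) :
    Fintype.card {a : Atom K c // k ∉ a.1.2} = ∑ y, (K - 1).choose (c y) := by
  rw [Fintype.card_congr ((Equiv.subtypeSubtypeEquivSubtypeInter
      (fun a : Y × Finset (Fin K) => a.2.card = c a.1) fun a => k ∉ a.2).trans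
    (Equiv.subtypeProdEquivSigmaSubtype fun y (s : Finset (Fin K)) => s.card = c y ∧ k ∉ s)),
    Fintype.card_sigma]
  refine Finset.sum_congr rfl fun y _ => ?_
  have : (Finset.univ.filter fun s : Finset (Fin K) => s.card = c y ∧ k ∉ s) =
      (Finset.univ.erase k).powersetCard (c y) := by
    ext s
    simp only [Finset.mem_filter_univ, Finset.mem_powersetCard, Finset.subset_erase,
      Finset.subset_univ, true_and]
    tauto
  rw [Fintype.card_subtype, this, Finset.card_powersetCard, Finset.card_erase_of_mem
    (Finset.mem_univ k), Finset.card_univ, Fintype.card_fin]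

theorem card_atom_mem (k : Fin K) :
    Fintype.card {a : Atom K c // k ∈ a.1.2} =
      ∑ y, K.choose (c y) - ∑ y, (K - 1).choose (c y) := by
  have := Fintype.card_subtype_compl fun a : Atom K c => k ∈ a.1.2
  have hle := Fintype.card_subtype_le fun a : Atom K c => k ∈ a.1.2
  rw [card_atom_notMem] at this
  rw [card_atom] at this hle
  omega

/-- The count does not depend on `k`, which permits a common cache length. -/
theorem card_cacheIdx (N L : ℕ) (k : Fin K) : Fintype.card (CacheIdx N L c k) =
    (∑ y, K.choose (c y) - ∑ y, (K - 1).choose (c y)) * (N * L) +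
      (∑ y, (K - 1).choose (c y)) * L := by
  rw [Fintype.card_sum, Fintype.card_prod, Fintype.card_prod, Fintype.card_prod, card_atom_mem,
    card_atom_notMem, Fintype.card_fin, Fintype.card_fin]

end Card

/-! ### Extension fields and the parameters of the coded schemes -/

theorem exists_field_extension (F : Type u) [Field F] [Fintype F] {m : ℕ} (hm : 0 < m) :
    ∃ (E : Type u) (_ : Field E) (_ : Fintype E) (_ : Algebra F E),
      Nonempty (E ≃ₗ[F] (Fin m → F)) ∧ m ≤ Fintype.card E := by
  classical
  obtain ⟨p, hp⟩ := CharP.exists F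
  have : Fact p.Prime := ⟨CharP.char_is_prime F p⟩
  have : NeZero m := ⟨hm.ne'⟩
  let E := ULift.{u} (FiniteField.Extension F p m)
  have e : E ≃ₗ[F] (Fin m → F) := ULift.moduleEquiv.trans
    (Module.finBasisOfFinrankEq F _ (FiniteField.finrank_extension F p m)).equivFun
  let _ : Fintype E := Fintype.ofEquiv _ e.symm.toEquiv
  refine ⟨E, inferInstance, inferInstance, inferInstance, ⟨e⟩, ?_⟩
  rw [Fintype.card_congr e.toEquiv]
  simp only [Fintype.card_pi, Finset.prod_const, Finset.card_univ, Fintype.card_fin]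
  exact (Nat.lt_pow_self Fintype.one_lt_card).le

/-- The coded schemes with layers of levels `c` and packets of length `m`. -/
theorem exists_coded_scheme (F : Type u) [Field F] [Fintype F] {N K H A I J L : ℕ}
    (hAI : A ≤ I) (hJ : I + L + A ≤ J) (hL : 0 < L)
    {Y : Type} [Fintype Y] (c : Y → ℕ) (hc : 0 < ∑ y, K.choose (c y)) {m : ℕ} (hm : 0 < m)
    (hH : H ≤ m) :
    ∃ S : Scheme F N K H, S.IsValid A I J ∧
      S.B = (∑ y, K.choose (c y)) * L * m ∧
      S.storageLen = (N * ∑ y, K.choose (c y) + ∑ y, K.choose (c y + 1)) * m ∧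
      S.cacheLen = N + ((∑ y, K.choose (c y) - ∑ y, (K - 1).choose (c y)) * (N * L) +
        (∑ y, (K - 1).choose (c y)) * L) * m ∧
      (∀ h, S.signalLen h = K * N + (∑ y, K.choose (c y + 1)) * m) ∧
      Nonempty (S.Packetization ((∑ y, K.choose (c y)) * L)) := by
  obtain ⟨E, _, _, _, ⟨e⟩, hE⟩ := exists_field_extension F hm
  have hcard : Fintype.card (Atom K c × Fin L) = (∑ y, K.choose (c y)) * L := by
    rw [Fintype.card_prod, card_atom, Fintype.card_fin]
  -- Distinct evaluation points exist because H ≤ m ≤ |E|.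
  obtain ⟨f⟩ := Function.Embedding.nonempty_of_card_le
    (α := Fin H) (β := E) (by simpa using hH.trans hE)
  let G : CodedData E F N K H L c :=
    { m := m
      coord := e
      point := f
      point_injective := f.injective
      cacheCount := _
      cacheEquiv := fun k => (Fintype.equivFinOfCardEq (card_cacheIdx N L k)).symm
      pos := by
        rw [hcard]
        exact Nat.mul_pos (Nat.mul_pos hc hL) hm }
  refine ⟨G.scheme I, G.isValid hAI hJ hL, ?_, ?_, rfl, fun h => ?_, ?_⟩
  · change Fintype.card (Atom K c × Fin L) * m = _
    rw [hcard]
  · change Fintype.card (StoreIdx N K c) * m = _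
    rw [Fintype.card_sum, Fintype.card_prod, card_atom, card_keyAtom, Fintype.card_fin]
  · change K * N + Fintype.card (KeyAtom K c) * m = _
    rw [card_keyAtom]
  · rw [← hcard]
    exact G.nonempty_packetization I

/-! ### Achievability -/

theorem choose_succ_eq {K t : ℕ} (ht : t ≤ K) :
    (K.choose (t + 1) : ℝ) = K.choose t * (((K : ℝ) - t) / ((t : ℝ) + 1)) := by
  have h : (K.choose (t + 1) : ℝ) * ((t : ℝ) + 1) = K.choose t * ((K : ℝ) - t) := by
    have := Nat.choose_succ_right_eq K t
    rw [← Nat.cast_sub ht]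
    exact_mod_cast this
  have : (t : ℝ) + 1 ≠ 0 := by positivity
  field_simp
  linarith

theorem choose_pred_eq {K t : ℕ} (hK : 0 < K) (ht : t ≤ K) :
    ((K - 1).choose t : ℝ) = K.choose t * (((K : ℝ) - t) / K) := by
  obtain ⟨K, rfl⟩ : ∃ k, K = k + 1 := ⟨K - 1, by omega⟩
  have h : (K.choose t : ℝ) * ((K + 1 : ℕ) : ℝ) = (K + 1).choose t * (((K + 1 : ℕ) : ℝ) - t) := by
    have := Nat.choose_mul_succ_eq K t
    rw [← Nat.cast_sub ht]
    exact_mod_cast this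
  have : ((K + 1 : ℕ) : ℝ) ≠ 0 := by positivity
  rw [Nat.add_sub_cancel]
  field_simp
  linarith

/-- The coded schemes achieve every weighted mean of the corner points. -/
theorem exists_scheme_near_mean (F : Type u) [Field F] [Fintype F] {N K H A I J L : ℕ}
    (hN : 0 < N) (hK : 0 < K) (hAI : A ≤ I) (hJ : I + L + A ≤ J) (hL : 0 < L)
    {Y : Type} [Fintype Y] (c : Y → ℕ) (hcK : ∀ y, c y ≤ K) (hc : 0 < ∑ y, K.choose (c y))
    {ε : ℝ} (hε : 0 < ε) :
    ∃ S : Scheme F N K H, S.IsValid A I J ∧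
      S.memorySize < (∑ y, (K.choose (c y) : ℝ) * memPoint N K (c y)) /
        (∑ y, (K.choose (c y) : ℝ)) + ε ∧
      S.storageSize < (∑ y, (K.choose (c y) : ℝ) * storagePoint N K L (c y)) /
        (∑ y, (K.choose (c y) : ℝ)) + ε ∧
      S.load < (∑ y, (K.choose (c y) : ℝ) * loadPoint K L (c y)) /
        (∑ y, (K.choose (c y) : ℝ)) + ε ∧
      Nonempty (S.Packetization ((∑ y, K.choose (c y)) * L)) := by
  -- The headers have N and K N symbols against a file length of at least m, so this m makes their
  -- normalized size smaller than ε.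
  obtain ⟨m₀, hm₀⟩ := exists_nat_gt (((K : ℝ) + 1) * N / ε)
  set m := max (max m₀ H) 1 with hm
  have hm1 : 0 < m := by omega
  have hmε : ((K : ℝ) + 1) * N < ε * m := by
    have h1 : (m₀ : ℝ) ≤ m := by exact_mod_cast (by omega : m₀ ≤ m)
    have := (div_lt_iff₀ hε).1 (hm₀.trans_le h1)
    linarith
  obtain ⟨S, hS, hB, hZ, hC, hX, hpack⟩ :=
    exists_coded_scheme F hAI hJ hL c hc hm1 (by omega : H ≤ m) (N := N)
  refine ⟨S, hS, ?_, ?_, ?_, hpack⟩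
  all_goals
    have hLr : (0 : ℝ) < L := by exact_mod_cast hL
    have hKr : (0 : ℝ) < K := by exact_mod_cast hK
    have hmr : (0 : ℝ) < m := by exact_mod_cast hm1
    have hNr : (0 : ℝ) < N := by exact_mod_cast hN
    have hL1 : (1 : ℝ) ≤ L := by exact_mod_cast hL
    have hB' : (S.B : ℝ) = (∑ y, (K.choose (c y) : ℝ)) * L * m := by rw [hB]; push_cast; rfl
    have hα1 : (1 : ℝ) ≤ ∑ y, (K.choose (c y) : ℝ) := by exact_mod_cast hc
    set α := ∑ y, (K.choose (c y) : ℝ) with hα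
    have hα0 : 0 < α := by linarith
    have hαL : 1 ≤ α * L := one_le_mul_of_one_le_of_one_le hα1 hL1
  · have hle : ∑ y, (K - 1).choose (c y) ≤ ∑ y, K.choose (c y) :=
      Finset.sum_le_sum fun y _ => Nat.choose_le_choose _ (Nat.sub_le K 1)
    -- A subfile costs N packets per data index if its set contains the user and one packet
    -- otherwise. A fraction t / K of the sets contain the user, and t N / K + (K - t) / K = M_t.
    have hmean : ∑ y, (K.choose (c y) : ℝ) * memPoint N K (c y) =
        (α - ∑ y, ((K - 1).choose (c y) : ℝ)) * N + ∑ y, ((K - 1).choose (c y) : ℝ) := by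
      rw [hα, sub_mul, Finset.sum_mul, Finset.sum_mul, ← Finset.sum_sub_distrib,
        ← Finset.sum_add_distrib]
      refine Finset.sum_congr rfl fun y _ => ?_
      rw [choose_pred_eq hK (hcK y), memPoint]
      field_simp
      ring
    rw [hmean, Scheme.memorySize, hB', hC]
    push_cast [Nat.cast_sub hle]
    rw [div_add' _ _ _ hα0.ne', div_lt_div_iff₀ (by positivity) hα0]
    have : (N : ℝ) < ε * (α * L * m) := by
      calc (N : ℝ) ≤ ((K : ℝ) + 1) * N := by nlinarith
        _ < ε * m := hmε
        _ ≤ (ε * m) * (α * L) := le_mul_of_one_le_right (by positivity) hαL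
        _ = _ := by ring
    rw [← hα]
    nlinarith [mul_lt_mul_of_pos_left this hα0]
  · have hmean : ∑ y, (K.choose (c y) : ℝ) * storagePoint N K L (c y) =
        (N * α + ∑ y, (K.choose (c y + 1) : ℝ)) / L := by
      rw [hα, Finset.mul_sum, ← Finset.sum_add_distrib, Finset.sum_div]
      refine Finset.sum_congr rfl fun y _ => ?_
      rw [choose_succ_eq (hcK y), storagePoint]
      field_simp
    rw [hmean, Scheme.storageSize, hB', hZ]
    push_cast
    rw [← hα]
    have : (N * α + ∑ y, (K.choose (c y + 1) : ℝ)) * m / (α * L * m) =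
        (N * α + ∑ y, (K.choose (c y + 1) : ℝ)) / L / α := by
      field_simp
    linarith
  · have hmean : ∑ y, (K.choose (c y) : ℝ) * loadPoint K L (c y) =
        (∑ y, (K.choose (c y + 1) : ℝ)) / L := by
      rw [Finset.sum_div]
      refine Finset.sum_congr rfl fun y _ => ?_
      rw [choose_succ_eq (hcK y), loadPoint]
      field_simp
    have hsup : ((Finset.univ.sup S.signalLen : ℕ) : ℝ) ≤
        K * N + (∑ y, (K.choose (c y + 1) : ℝ)) * m := by
      have : Finset.univ.sup S.signalLen ≤ K * N + (∑ y, K.choose (c y + 1)) * m :=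
        Finset.sup_le fun h _ => (hX h).le
      exact_mod_cast this
    rw [hmean, Scheme.load, hB', div_div]
    refine (div_le_div_of_nonneg_right hsup (by positivity)).trans_lt ?_
    rw [div_add' _ _ _ (by positivity), div_lt_div_iff₀ (by positivity) (by positivity)]
    have : (K : ℝ) * N < ε * (α * L * m) := by
      calc (K : ℝ) * N ≤ ((K : ℝ) + 1) * N := by nlinarith
        _ < ε * m := hmε
        _ ≤ (ε * m) * (α * L) := le_mul_of_one_le_right (by positivity) hαL
        _ = _ := by ring
    nlinarith [mul_lt_mul_of_pos_left this (mul_pos hLr hα0)]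

/-- The weighted mean over `(n - j) (K choose t + 1)` layers of level `t` and `j (K choose t)`
layers of level `t + 1`. -/
theorem mean_two_levels {K t j n : ℕ} (hj : j ≤ n) (f : ℕ → ℝ) :
    ∑ y : Fin ((n - j) * K.choose (t + 1)) ⊕ Fin (j * K.choose t),
      (K.choose (Sum.elim (fun _ => t) (fun _ => t + 1) y) : ℝ) *
        f (Sum.elim (fun _ => t) (fun _ => t + 1) y) =
      (K.choose t : ℝ) * K.choose (t + 1) * (((n : ℝ) - j) * f t + j * f (t + 1)) := by
  rw [Fintype.sum_sum_type]
  simp only [Sum.elim_inl, Sum.elim_inr, Finset.sum_const, Finset.card_univ, Fintype.card_fin,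
    nsmul_eq_mul]
  push_cast [Nat.cast_sub hj]
  ring

/-- Memory sharing inside one scheme: the numbers of layers of levels t and t + 1 are chosen so that
their numbers of subfiles stand in the ratio (n - j) : j, with j / n close to θ. -/
theorem exists_scheme_near_segment (F : Type u) [Field F] [Fintype F] {N K H A I J L : ℕ}
    (hN : 0 < N) (hAI : A ≤ I) (hJ : I + L + A ≤ J) (hL : 0 < L) {t : ℕ} (ht : t + 1 ≤ K)
    {θ : ℝ} (h0 : 0 ≤ θ) (h1 : θ ≤ 1) {ε : ℝ} (hε : 0 < ε) :
    ∃ S : Scheme F N K H, S.IsValid A I J ∧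
      S.memorySize < (1 - θ) * memPoint N K t + θ * memPoint N K (t + 1) + ε ∧
      S.storageSize < (1 - θ) * storagePoint N K L t + θ * storagePoint N K L (t + 1) + ε ∧
      S.load < (1 - θ) * loadPoint K L t + θ * loadPoint K L (t + 1) + ε := by
  set f := memPoint N K
  set g := storagePoint N K L
  set h := loadPoint K L
  set C := |f (t + 1) - f t| + |g (t + 1) - g t| + |h (t + 1) - h t| with hC
  have hC0 : 0 ≤ C := by positivity
  obtain ⟨n₀, hn₀⟩ := exists_nat_gt (C / (ε / 2))
  set n := n₀ + 1
  have hn : (0 : ℝ) < n := by positivity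
  have hCn : C / n < ε / 2 := by
    rw [div_lt_iff₀ hn]
    have := (div_lt_iff₀ (half_pos hε)).1 (hn₀.trans (by exact_mod_cast Nat.lt_succ_self n₀ :
      (n₀ : ℝ) < n))
    linarith
  -- Rounding θ to j / n costs at most C / n in each coordinate, less than half of ε; the other half
  -- is left for the headers.
  set j := ⌊θ * n⌋₊
  have hj1 : (j : ℝ) ≤ θ * n := Nat.floor_le (by positivity)
  have hj2 : θ * n < j + 1 := Nat.lt_floor_add_one _
  have hjn : j ≤ n := by
    have : (j : ℝ) ≤ n := hj1.trans (by nlinarith)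
    exact_mod_cast this
  have hclose : ∀ p : ℕ → ℝ, |p (t + 1) - p t| ≤ C →
      (((n : ℝ) - j) * p t + j * p (t + 1)) / n + ε / 2 < (1 - θ) * p t + θ * p (t + 1) + ε := by
    intro p hp
    have e1 : (((n : ℝ) - j) * p t + j * p (t + 1)) / n =
        (1 - θ) * p t + θ * p (t + 1) - (θ * n - j) / n * (p (t + 1) - p t) := by
      field_simp
      ring
    have e2 : -((θ * n - j) / n * (p (t + 1) - p t)) ≤ C / n := by
      have hd : 0 ≤ (θ * n - j) / n := div_nonneg (by linarith) hn.le
      have hd' : (θ * n - j) / n ≤ 1 / n := div_le_div_of_nonneg_right (by linarith) hn.le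
      calc -((θ * n - j) / n * (p (t + 1) - p t)) = (θ * n - j) / n * -(p (t + 1) - p t) := by ring
        _ ≤ (θ * n - j) / n * C :=
          mul_le_mul_of_nonneg_left ((neg_le_abs _).trans hp) hd
        _ ≤ 1 / n * C := mul_le_mul_of_nonneg_right hd' hC0
        _ = C / n := by ring
    rw [e1]
    linarith
  have ha : (0 : ℝ) < K.choose t := by exact_mod_cast Nat.choose_pos (by omega)
  have hb : (0 : ℝ) < K.choose (t + 1) := by exact_mod_cast Nat.choose_pos ht
  let c : Fin ((n - j) * K.choose (t + 1)) ⊕ Fin (j * K.choose t) → ℕ :=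
    Sum.elim (fun _ => t) (fun _ => t + 1)
  have hmean : ∀ p : ℕ → ℝ, ∑ y, (K.choose (c y) : ℝ) * p (c y) =
      (K.choose t : ℝ) * K.choose (t + 1) * (((n : ℝ) - j) * p t + j * p (t + 1)) :=
    mean_two_levels hjn
  have hsum : ∑ y, (K.choose (c y) : ℝ) = (K.choose t : ℝ) * K.choose (t + 1) * n := by
    have := hmean fun _ => 1
    simp only [mul_one] at this
    rw [this]
    ring
  have hpos : 0 < ∑ y, K.choose (c y) := by
    have : (0 : ℝ) < ∑ y, (K.choose (c y) : ℝ) := by rw [hsum]; positivity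
    exact_mod_cast this
  have hquot : ∀ p : ℕ → ℝ, (∑ y, (K.choose (c y) : ℝ) * p (c y)) / ∑ y, (K.choose (c y) : ℝ) =
      (((n : ℝ) - j) * p t + j * p (t + 1)) / n := fun p => by
    rw [hmean, hsum, mul_div_mul_left _ _ (by positivity)]
  obtain ⟨S, hS, h1, h2, h3, -⟩ := exists_scheme_near_mean F (H := H) hN (by omega) hAI hJ hL c
    (by rintro (y | y) <;> simp [c] <;> omega) hpos (half_pos hε)
  rw [hquot] at h1 h2 h3
  refine ⟨S, hS, h1.trans (hclose f ?_), h2.trans (hclose g ?_), h3.trans (hclose h ?_)⟩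
  all_goals
    rw [hC]
    have := abs_nonneg (f (t + 1) - f t)
    have := abs_nonneg (g (t + 1) - g t)
    have := abs_nonneg (h (t + 1) - h t)
    linarith

/-! ### The curve -/

theorem exists_segment {N K : ℕ} (hN : 2 ≤ N) (hK : 0 < K) {M : ℝ} (h1 : 1 ≤ M) (hM : M ≤ N) :
    ∃ (t : ℕ) (θ : ℝ), t + 1 ≤ K ∧ 0 ≤ θ ∧ θ ≤ 1 ∧
      M = (1 - θ) * memPoint N K t + θ * memPoint N K (t + 1) ∧
      (K : ℝ) * (M - 1) = (t + θ) * (N - 1) := by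
  have hN' : (0 : ℝ) < (N : ℝ) - 1 := by
    have : (2 : ℝ) ≤ N := by exact_mod_cast hN
    linarith
  have hK' : (0 : ℝ) < K := by exact_mod_cast hK
  set τ : ℝ := (K : ℝ) * (M - 1) / ((N : ℝ) - 1) with hτ
  have hτ' : (K : ℝ) * (M - 1) = τ * (N - 1) := by rw [hτ]; field_simp
  have hτ0 : 0 ≤ τ := div_nonneg (mul_nonneg hK'.le (by linarith)) hN'.le
  have hτK : τ ≤ K := by
    rw [hτ, div_le_iff₀ hN']
    nlinarith
  have key : ∃ t : ℕ, t + 1 ≤ K ∧ (t : ℝ) ≤ τ ∧ τ ≤ t + 1 := by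
    rcases hτK.lt_or_eq with h | h
    · exact ⟨⌊τ⌋₊, (Nat.floor_lt hτ0).2 h, Nat.floor_le hτ0, (Nat.lt_floor_add_one τ).le⟩
    -- At M = N the floor would give t = K, beyond the last segment; the point is taken as the right
    -- end of the segment from K - 1.
    · have hcast : ((K - 1 : ℕ) : ℝ) = K - 1 := by
        rw [Nat.cast_sub hK, Nat.cast_one]
      exact ⟨K - 1, by omega, by rw [hcast, h]; linarith, by rw [hcast, h]; linarith⟩
  obtain ⟨t, ht, h2, h3⟩ := key
  refine ⟨t, τ - t, ht, by linarith, by linarith, ?_, by rw [add_sub_cancel, hτ']⟩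
  unfold memPoint
  push_cast
  field_simp
  linarith

/-- The load coordinate of the curve for `L = 1`. -/
def segmentLoad (K t : ℕ) (θ : ℝ) : ℝ :=
  (1 - θ) * (((K : ℝ) - t) / ((t : ℝ) + 1)) + θ * (((K : ℝ) - (t + 1)) / ((t : ℝ) + 2))

/-! ### Estimates for the load of the curve -/

section SegmentLoad

variable {K t : ℕ} {θ : ℝ}

theorem segmentLoad_nonneg (ht : t + 1 ≤ K) (h0 : 0 ≤ θ) (h1 : θ ≤ 1) : 0 ≤ segmentLoad K t θ := by
  have : (t : ℝ) + 1 ≤ K := by exact_mod_cast ht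
  exact add_nonneg (mul_nonneg (by linarith) (div_nonneg (by linarith) (by positivity)))
    (mul_nonneg h0 (div_nonneg (by linarith) (by positivity)))

/-- Holds at both ends of the segment, hence along it. In terms of M it becomes f (N - 1) ≤ K (N -
M). -/
theorem segmentLoad_le_sub (ht : t + 1 ≤ K) (h0 : 0 ≤ θ) (h1 : θ ≤ 1) :
    segmentLoad K t θ ≤ K - (t + θ) := by
  have hK : (t : ℝ) + 1 ≤ K := by exact_mod_cast ht
  have ht0 : (0 : ℝ) ≤ t := Nat.cast_nonneg t
  have e1 : ((K : ℝ) - t) / ((t : ℝ) + 1) ≤ K - t := div_le_self (by linarith) (by linarith)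
  have e2 : ((K : ℝ) - (t + 1)) / ((t : ℝ) + 2) ≤ K - (t + 1) :=
    div_le_self (by linarith) (by linarith)
  unfold segmentLoad
  nlinarith [mul_le_mul_of_nonneg_left e1 (by linarith : 0 ≤ 1 - θ),
    mul_le_mul_of_nonneg_left e2 h0]

/-- Adding 1 turns (K - t) / (t + 1) into (K + 1) / (t + 1), which interpolates in closed form. -/
theorem segmentLoad_add_one : (segmentLoad K t θ + 1) * (((t : ℝ) + 1) * (t + 2)) =
    ((K : ℝ) + 1) * (t + 2 - θ) := by
  unfold segmentLoad
  field_simp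
  ring

/-- By the mean inequality (t + 2 - θ)(t + θ) ≤ (t + 1)², and (K + 1)(t + 1) ≤ K (t + 2) because t +
1 ≤ K. In terms of M it becomes f (M - 1) ≤ N - M. -/
theorem segmentLoad_mul_le (ht : t + 1 ≤ K) :
    segmentLoad K t θ * (t + θ) ≤ K - (t + θ) := by
  have hK : (t : ℝ) + 1 ≤ K := by exact_mod_cast ht
  have ht0 : (0 : ℝ) ≤ t := Nat.cast_nonneg t
  have hq : (0 : ℝ) < ((t : ℝ) + 1) * (t + 2) := by positivity
  have e : (segmentLoad K t θ + 1) * (t + θ) ≤ K := by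
    refine le_of_mul_le_mul_right ?_ hq
    calc (segmentLoad K t θ + 1) * (t + θ) * (((t : ℝ) + 1) * (t + 2))
        = ((K : ℝ) + 1) * ((t + 2 - θ) * (t + θ)) := by
          rw [mul_right_comm, segmentLoad_add_one]; ring
      _ ≤ ((K : ℝ) + 1) * ((t + 1) * (t + 1)) :=
          mul_le_mul_of_nonneg_left (by nlinarith [sq_nonneg (1 - θ)]) (by linarith)
      _ ≤ K * ((t + 1) * (t + 2)) := by nlinarith
  linarith

/-- Makes the key part of the storage at most the file part, whence the factor 2. The second
alternative is M ≥ 2, rewritten with K (M - 1) = (t + θ)(N - 1). -/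
theorem segmentLoad_le_of_le {N : ℕ} (hN : 2 ≤ N) (ht : t + 1 ≤ K) (h0 : 0 ≤ θ) (h1 : θ ≤ 1)
    (h : K ≤ N ∨ (K : ℝ) ≤ (t + θ) * (N - 1)) : segmentLoad K t θ ≤ N := by
  have ht0 : (0 : ℝ) ≤ t := Nat.cast_nonneg t
  rcases h with h | h
  · have h' : (K : ℝ) ≤ N := by exact_mod_cast h
    linarith [segmentLoad_le_sub ht h0 h1]
  · have hN' : (2 : ℝ) ≤ N := by exact_mod_cast hN
    have hq : (0 : ℝ) < ((t : ℝ) + 1) * (t + 2) := by positivity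
    have e : segmentLoad K t θ + 1 ≤ N := by
      refine le_of_mul_le_mul_right ?_ hq
      rw [segmentLoad_add_one]
      calc ((K : ℝ) + 1) * (t + 2 - θ) ≤ ((t + θ) * (N - 1) + 1) * (t + 2 - θ) :=
            mul_le_mul_of_nonneg_right (by linarith) (by linarith)
        _ = ((t + 2 - θ) * (t + θ)) * (N - 1) + (t + 2 - θ) := by ring
        _ ≤ ((t + 1) * (t + 2)) * (N - 1) + (t + 1) * (t + 2) := by
            refine add_le_add (mul_le_mul_of_nonneg_right ?_ (by linarith)) ?_
            · nlinarith [sq_nonneg (1 - θ)]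
            · nlinarith
        _ = _ := by ring
    linarith

end SegmentLoad

theorem curveLoad_segment {N K L t : ℕ} (hN : 2 ≤ N) (hK : 0 < K) {θ : ℝ} (h0 : 0 ≤ θ)
    (h1 : θ ≤ 1) : curveLoad N K L ((1 - θ) * memPoint N K t + θ * memPoint N K (t + 1)) =
      segmentLoad K t θ / L := by
  rw [curveLoad, interpolate_segment hN hK _ _ h0 h1, segmentLoad, loadPoint, loadPoint]
  rcases eq_or_ne (L : ℝ) 0 with h | h
  · simp [h]
  · push_cast
    field_simp
    ring

theorem curveStorage_segment {N K L t : ℕ} (hN : 2 ≤ N) (hK : 0 < K) {θ : ℝ} (h0 : 0 ≤ θ)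
    (h1 : θ ≤ 1) : curveStorage N K L ((1 - θ) * memPoint N K t + θ * memPoint N K (t + 1)) =
      (N + segmentLoad K t θ) / L := by
  rw [curveStorage, interpolate_segment hN hK _ _ h0 h1, segmentLoad, storagePoint, storagePoint]
  rcases eq_or_ne (L : ℝ) 0 with h | h
  · simp [h]
  · push_cast
    field_simp
    ring

/-! ### Comparison with the cut-set bound -/

/-- Here m is 2 (a + 1) rounded up and s is N / m rounded down. About half of s survives the
subtraction of s M / m, and f ≤ (N - 1) / a; the constant 12 leaves room for both roundings. -/
theorem le_cutset_of_ceil {f a M N m s : ℝ} (ha : 1 ≤ a) (hM : M ≤ a + 1)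
    (hf : f * a ≤ N - 1) (hN : 12 * a ≤ N) (hm1 : 2 * (a + 1) ≤ m) (hm2 : m ≤ 2 * (a + 1) + 1)
    (hs : N + 1 ≤ s * m + m) : f ≤ 12 * (s - s * M / m) := by
  have hm : 0 < m := by linarith
  have hs0 : 0 ≤ s := by
    by_contra h
    nlinarith
  have h1 : s - s * M / m = s * (m - M) / m := by field_simp
  have h2 : s * (m - (a + 1)) / m ≤ s * (m - M) / m :=
    div_le_div_of_nonneg_right (mul_le_mul_of_nonneg_left (by linarith) hs0) hm.le
  have h3 : (N + 1 - m) * (m - (a + 1)) / m ^ 2 ≤ s * (m - (a + 1)) / m := by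
    rw [div_le_div_iff₀ (by positivity) hm]
    have : (N + 1 - m) * (m - (a + 1)) ≤ s * m * (m - (a + 1)) :=
      mul_le_mul_of_nonneg_right (by linarith) (by linarith)
    nlinarith
  have h4 : (N - 1) * m ^ 2 ≤ 12 * ((N + 1 - m) * (m - (a + 1))) * a := by
    -- The difference of the two sides is a concave quadratic in the rounding error δ ∈ [0, 1]. So
    -- it lies above its chord, and the ends δ = 0 and δ = 1 suffice (`e0`, `e1`); `e2` is this
    -- decomposition.
    set δ := m - 2 * (a + 1) with hδ
    have hmδ : m = 2 * (a + 1) + δ := by rw [hδ]; ring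
    have e0 : 0 ≤ 12 * ((N + 1 - 2 * (a + 1)) * (a + 1)) * a - (N - 1) * (2 * (a + 1)) ^ 2 := by
      have : 12 * ((N + 1 - 2 * (a + 1)) * (a + 1)) * a - (N - 1) * (2 * (a + 1)) ^ 2 =
          (a + 1) * ((8 * a - 4) * (N - 12 * a) + (72 * a ^ 2 - 56 * a + 4)) := by ring
      rw [this]
      refine mul_nonneg (by linarith) (add_nonneg (mul_nonneg (by linarith) (by linarith)) ?_)
      nlinarith
    have e1 : 0 ≤ 12 * ((N - 2 * (a + 1)) * (a + 2)) * a - (N - 1) * (2 * (a + 1) + 1) ^ 2 := by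
      have : 12 * ((N - 2 * (a + 1)) * (a + 2)) * a - (N - 1) * (2 * (a + 1) + 1) ^ 2 =
          (8 * a ^ 2 + 12 * a - 9) * (N - 12 * a) + (72 * a ^ 3 + 76 * a ^ 2 - 144 * a + 9) := by
        ring
      rw [this]
      refine add_nonneg (mul_nonneg (by nlinarith) (by linarith)) ?_
      nlinarith [mul_nonneg (sub_nonneg.2 ha) (sub_nonneg.2 ha),
        mul_nonneg (mul_nonneg (sub_nonneg.2 ha) (sub_nonneg.2 ha)) (by linarith : 0 ≤ a)]
    have e2 : 12 * ((N + 1 - m) * (m - (a + 1))) * a - (N - 1) * m ^ 2 =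
        (1 - δ) * (12 * ((N + 1 - 2 * (a + 1)) * (a + 1)) * a - (N - 1) * (2 * (a + 1)) ^ 2) +
        δ * (12 * ((N - 2 * (a + 1)) * (a + 2)) * a - (N - 1) * (2 * (a + 1) + 1) ^ 2) +
        (12 * a + (N - 1)) * (δ * (1 - δ)) := by
      rw [hmδ]
      ring
    have hδ0 : 0 ≤ δ := by linarith
    have hδ1 : 0 ≤ 1 - δ := by linarith
    have := mul_nonneg hδ1 e0
    have := mul_nonneg hδ0 e1
    have := mul_nonneg (by linarith : 0 ≤ 12 * a + (N - 1)) (mul_nonneg hδ0 hδ1)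
    linarith
  have h5 : f ≤ 12 * ((N + 1 - m) * (m - (a + 1)) / m ^ 2) := by
    rw [← mul_div_assoc, le_div_iff₀ (by positivity)]
    refine le_of_mul_le_mul_right ?_ (by linarith : 0 < a)
    calc f * m ^ 2 * a = f * a * m ^ 2 := by ring
      _ ≤ (N - 1) * m ^ 2 := mul_le_mul_of_nonneg_right hf (by positivity)
      _ ≤ _ := h4
  rw [h1]
  linarith

/-- The load of the curve is within a factor `12` of the best cut-set bound. -/
theorem exists_cutset {N K : ℕ} (hN : 2 ≤ N) (hK : 0 < K) {M f : ℝ} (h1 : 1 ≤ M) (hM : M ≤ N)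
    (hf0 : 0 ≤ f) (hf1 : f * (N - 1) ≤ K * (N - M)) (hf2 : f * (M - 1) ≤ N - M)
    (hKM : K ≤ N ∨ 2 ≤ M) :
    ∃ s m : ℕ, s ≤ K ∧ 0 < m ∧ m * s ≤ N ∧ f ≤ 12 * (s - s * M / m) := by
  have hN' : (2 : ℝ) ≤ N := by exact_mod_cast hN
  have hK' : (1 : ℝ) ≤ K := by exact_mod_cast hK
  -- With few users or a large memory, one user that requests all N files in turn gives a sufficient
  -- bound: f N ≤ 12 (N - M) follows from `hf1` or `hf2`.
  by_cases hA : (K : ℝ) * N ≤ 12 * (N - 1) ∨ (N : ℝ) ≤ 12 * (M - 1)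
  · refine ⟨1, N, hK, by omega, by omega, ?_⟩
    have key : f * N ≤ 12 * (N - M) := by
      rcases hA with h | h
      · refine le_of_mul_le_mul_right ?_ (by linarith : (0 : ℝ) < N - 1)
        calc f * N * (N - 1) = f * (N - 1) * N := by ring
          _ ≤ K * (N - M) * N := mul_le_mul_of_nonneg_right hf1 (by linarith)
          _ = K * N * (N - M) := by ring
          _ ≤ 12 * (N - 1) * (N - M) := mul_le_mul_of_nonneg_right h (by linarith)
          _ = _ := by ring
      · nlinarith [mul_le_mul_of_nonneg_left h hf0]
    have : (12 : ℝ) * ((1 : ℕ) - (1 : ℕ) * M / N) = 12 * (N - M) / N := by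
      push_cast
      field_simp
    rw [this, le_div_iff₀ (by linarith)]
    exact key
  push Not at hA
  obtain ⟨hA1, hA2⟩ := hA
  have half : ∀ s m : ℕ, 0 < m → 2 * M ≤ m → f ≤ 6 * s → f ≤ 12 * (s - s * M / m) := by
    intro s m hm hmM hfs
    have hm' : (0 : ℝ) < m := by exact_mod_cast hm
    have hs : (0 : ℝ) ≤ s := Nat.cast_nonneg s
    have : s * M / m ≤ s / 2 := by
      rw [div_le_div_iff₀ hm' two_pos]
      nlinarith
    linarith
  by_cases hB : 2 ≤ M ∨ (K : ℝ) ≤ N - 1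
  -- The witness is the maximum of M - 1 and (N - 1) / K: `hf2` and `hf1` bound f a in the two
  -- cases, and 12 a ≤ N is the failure of the first case.
  · obtain ⟨a, ha1, hMa, hKa, hfa, hNa⟩ : ∃ a : ℝ, 1 ≤ a ∧ M ≤ a + 1 ∧ (N : ℝ) - 1 ≤ a * K ∧
        f * a ≤ N - 1 ∧ 12 * a ≤ N := by
      have hK0 : (0 : ℝ) < K := by linarith
      have hd : ((N : ℝ) - 1) / K * K = N - 1 := by field_simp
      rcases le_total (M - 1) (((N : ℝ) - 1) / K) with h | h
      · refine ⟨((N : ℝ) - 1) / K, ?_, by linarith, hd.ge, ?_, ?_⟩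
        · rcases hB with h' | h'
          · linarith
          · rwa [le_div_iff₀ hK0, one_mul]
        · rw [← mul_div_assoc, div_le_iff₀ hK0]
          nlinarith
        · rw [← mul_div_assoc, div_le_iff₀ hK0]
          linarith
      · refine ⟨M - 1, ?_, by linarith, ?_, by linarith, hA2.le⟩
        · rcases hB with h' | h'
          · linarith
          · refine le_trans ?_ h
            rwa [le_div_iff₀ hK0, one_mul]
        · rw [← hd]
          exact mul_le_mul_of_nonneg_right h hK0.le
    set m := ⌈2 * (a + 1)⌉₊ with hm
    have hm1 : 2 * (a + 1) ≤ m := Nat.le_ceil _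
    have hm2 : (m : ℝ) < 2 * (a + 1) + 1 := Nat.ceil_lt_add_one (by linarith)
    have hm' : (0 : ℝ) < m := by linarith
    have hm0 : 0 < m := by exact_mod_cast hm'
    have hs1 : ((N / m : ℕ) : ℝ) * m ≤ N := by exact_mod_cast Nat.div_mul_le_self N m
    have hs2 : (N : ℝ) + 1 ≤ ((N / m : ℕ) : ℝ) * m + m := by
      exact_mod_cast Nat.lt_div_mul_add hm0
    refine ⟨N / m, m, ?_, hm0, Nat.mul_div_le N m, ?_⟩
    -- At most K users are involved, since N ≤ a K + 1 ≤ 2 (a + 1) K.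
    · have h4 : ((N / m : ℕ) : ℝ) * (2 * (a + 1)) ≤ N :=
        (mul_le_mul_of_nonneg_left hm1 (Nat.cast_nonneg _)).trans hs1
      have h5 : ((N / m : ℕ) : ℝ) * (2 * (a + 1)) ≤ K * (2 * (a + 1)) := by nlinarith
      exact_mod_cast le_of_mul_le_mul_right h5 (by linarith)
    · exact le_cutset_of_ceil ha1 hMa hfa hNa hm1 hm2.le hs2
  -- What remains is K = N with M < 2. Four transmissions to N / 4 users suffice, as 2 M ≤ 4 and f ≤
  -- N ≤ 6 ⌊N / 4⌋ once N ≥ 9; smaller N contradict 12 (N - 1) < K N ≤ N².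
  · push Not at hB
    have hKN : K ≤ N := hKM.resolve_right (by linarith)
    have hKN' : (K : ℝ) ≤ N := by exact_mod_cast hKN
    have hN9 : 9 ≤ N := by
      by_contra h
      have : (N : ℝ) ≤ 8 := by exact_mod_cast (by omega : N ≤ 8)
      nlinarith
    have hfN : f ≤ N := by
      refine le_of_mul_le_mul_right ?_ (by linarith : (0 : ℝ) < N - 1)
      nlinarith
    refine ⟨N / 4, 4, ?_, by norm_num, Nat.mul_div_le N 4, half _ 4 (by norm_num) ?_ ?_⟩
    · have : N < K + 1 := by
        have : (N : ℝ) < K + 1 := by linarith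
        exact_mod_cast this
      omega
    · push_cast
      linarith
    · have : (N : ℝ) ≤ 6 * ((N / 4 : ℕ) : ℝ) := by exact_mod_cast (by omega : N ≤ 6 * (N / 4))
      linarith

/-! ### Achievable region, lower bounds and their comparison -/

section Main

variable (F : Type u) [Field F] [Fintype F] {N K H A I J L : ℕ}

theorem storagePoint_nonneg {t : ℕ} (ht : t ≤ K) : 0 ≤ storagePoint N K L t := by
  have : (t : ℝ) ≤ K := by exact_mod_cast ht
  have : 0 ≤ ((K : ℝ) - t) / ((t : ℝ) + 1) := div_nonneg (by linarith) (by positivity)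
  unfold storagePoint
  positivity

theorem loadPoint_nonneg {t : ℕ} (ht : t ≤ K) : 0 ≤ loadPoint K L t := by
  have : (t : ℝ) ≤ K := by exact_mod_cast ht
  exact div_nonneg (by linarith) (by positivity)

theorem achievable_of_curve_le (hN : 2 ≤ N) (hK : 0 < K) (hAI : A ≤ I) (hJ : I + L + A ≤ J)
    (hL : 0 < L) {M T R : ℝ} (h1 : 1 ≤ M) (hM : M ≤ N) (hT : curveStorage N K L M ≤ T)
    (hR : curveLoad N K L M ≤ R) : Achievable F N K H A I J M T R := by
  obtain ⟨t, θ, ht, h0, hθ, hMt, -⟩ := exists_segment hN hK h1 hM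
  have hs : curveStorage N K L M =
      (1 - θ) * storagePoint N K L t + θ * storagePoint N K L (t + 1) := by
    rw [hMt, curveStorage, interpolate_segment hN hK _ _ h0 hθ]
  have hl : curveLoad N K L M = (1 - θ) * loadPoint K L t + θ * loadPoint K L (t + 1) := by
    rw [hMt, curveLoad, interpolate_segment hN hK _ _ h0 hθ]
  have hθ' : 0 ≤ 1 - θ := by linarith
  refine ⟨h1, hM, ?_, ?_, fun ε hε => ?_⟩
  · refine le_trans ?_ hT
    rw [hs]
    exact add_nonneg (mul_nonneg hθ' (storagePoint_nonneg (by omega)))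
      (mul_nonneg h0 (storagePoint_nonneg ht))
  · refine le_trans ?_ hR
    rw [hl]
    exact add_nonneg (mul_nonneg hθ' (loadPoint_nonneg (by omega)))
      (mul_nonneg h0 (loadPoint_nonneg ht))
  · obtain ⟨S, hS, hm, hz, hx⟩ := exists_scheme_near_segment F (H := H) (N := N) (by omega) hAI hJ
      hL ht h0 hθ hε
    refine ⟨S, hS, by rwa [← hMt] at hm, hz.trans_le ?_, hx.trans_le ?_⟩
    · rw [← hs]
      linarith
    · rw [← hl]
      linarith

theorem achievableWithPackets_point (hN : 2 ≤ N) (hK : 0 < K) (hAI : A ≤ I)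
    (hJ : I + L + A ≤ J) (hL : 0 < L) {t : ℕ} (ht : t ≤ K) :
    AchievableWithPackets F N K H A I J (L * K.choose t) (memPoint N K t)
      (storagePoint N K L t) (loadPoint K L t) := by
  have hN' : (2 : ℝ) ≤ N := by exact_mod_cast hN
  have hK' : (0 : ℝ) < K := by exact_mod_cast hK
  have ht' : (t : ℝ) ≤ K := by exact_mod_cast ht
  refine ⟨?_, ?_, storagePoint_nonneg ht, loadPoint_nonneg ht, fun ε hε => ?_⟩
  · have : 0 ≤ (t : ℝ) * ((N : ℝ) - 1) / K :=
      div_nonneg (mul_nonneg (Nat.cast_nonneg t) (by linarith)) hK'.le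
    unfold memPoint
    linarith
  · have : (t : ℝ) * ((N : ℝ) - 1) / K ≤ N - 1 := by
      rw [div_le_iff₀ hK']
      nlinarith
    unfold memPoint
    linarith
  · have hpos := Nat.choose_pos ht
    have hne : (K.choose t : ℝ) ≠ 0 := by exact_mod_cast hpos.ne'
    obtain ⟨S, hS, h1, h2, h3, h4⟩ := exists_scheme_near_mean F (H := H) (N := N) (by omega) hK
      hAI hJ hL (fun _ : Unit => t) (fun _ => ht) (by simpa using hpos) hε
    simp only [Finset.univ_unique, Finset.sum_singleton] at h1 h2 h3 h4
    rw [mul_div_cancel_left₀ _ hne] at h1 h2 h3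
    rw [mul_comm] at h4
    exact ⟨S, hS, h1, h2, h3, h4⟩

variable {F}

theorem Achievable.storage_lower_bound {M T R : ℝ} (hIJ : I ≤ J) (hJH : J ≤ H)
    (h : Achievable F N K H A I J M T R) : (N : ℝ) ≤ (J - I) * T := by
  have hIJ' : (0 : ℝ) ≤ (J : ℝ) - I := sub_nonneg.2 (by exact_mod_cast hIJ)
  refine le_of_forall_pos_le_add fun δ hδ => ?_
  -- The tolerance is scaled so that after multiplication by J - I it stays below δ; the added 1
  -- avoids division by zero.
  obtain ⟨S, hS, -, hz, -⟩ := h.2.2.2.2 (δ / (J - I + 1)) (div_pos hδ (by linarith))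
  have hB : (0 : ℝ) < S.B := by exact_mod_cast S.B_pos
  have hb : (N : ℝ) * S.B ≤ (J - I) * S.storageLen := by
    rw [← Nat.cast_sub hIJ]
    exact_mod_cast hS.storage_bound hIJ hJH
  have h1 : (N : ℝ) ≤ (J - I) * S.storageSize := by
    rw [Scheme.storageSize, ← mul_div_assoc, le_div_iff₀ hB]
    exact hb
  have h2 : ((J : ℝ) - I) * (δ / (J - I + 1)) ≤ δ := by
    rw [← mul_div_assoc, div_le_iff₀ (by linarith)]
    nlinarith
  nlinarith [mul_le_mul_of_nonneg_left hz.le hIJ']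

theorem Achievable.load_lower_bound {M T R : ℝ} (hIJ : I ≤ J) (hJH : J ≤ H)
    (h : Achievable F N K H A I J M T R) {s m : ℕ} (hs : s ≤ K) (hm : 0 < m) (hsm : m * s ≤ N) :
    (s : ℝ) - s * M / m ≤ (J - I) * R := by
  have hIJ' : (0 : ℝ) ≤ (J : ℝ) - I := sub_nonneg.2 (by exact_mod_cast hIJ)
  have hm' : (0 : ℝ) < m := by exact_mod_cast hm
  have hs' : (0 : ℝ) ≤ s := Nat.cast_nonneg s
  have key : (m : ℝ) * s ≤ m * (J - I) * R + s * M := by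
    refine le_of_forall_pos_le_add fun δ hδ => ?_
    have hD : 0 < (m : ℝ) * (J - I) + s + 1 := by positivity
    obtain ⟨S, hS, hc, -, hx⟩ := h.2.2.2.2 (δ / (m * (J - I) + s + 1)) (div_pos hδ hD)
    have hB : (0 : ℝ) < S.B := by exact_mod_cast S.B_pos
    have hb : (m : ℝ) * s * S.B ≤
        m * (J - I) * (Finset.univ.sup S.signalLen : ℕ) + s * S.cacheLen := by
      rw [← Nat.cast_sub hIJ]
      exact_mod_cast hS.cutset_bound hIJ hJH hs hsm
    have h1 : (m : ℝ) * s ≤ m * (J - I) * S.load + s * S.memorySize := by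
      rw [Scheme.load, Scheme.memorySize, ← mul_div_assoc, ← mul_div_assoc, ← add_div,
        le_div_iff₀ hB]
      exact hb
    have h2 : ((m : ℝ) * (J - I) + s) * (δ / (m * (J - I) + s + 1)) ≤ δ := by
      rw [← mul_div_assoc, div_le_iff₀ hD]
      nlinarith
    have h3 := mul_le_mul_of_nonneg_left hx.le (mul_nonneg hm'.le hIJ')
    have h4 := mul_le_mul_of_nonneg_left hc.le hs'
    linarith
  refine le_of_mul_le_mul_left ?_ hm'
  have : (m : ℝ) * (s - s * M / m) = m * s - s * M := by field_simp
  rw [this]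
  linarith

variable (F)

/-- The factor `1 + 2 A / L` is `(J - I) / L`. -/
theorem one_add_eq_div (hL : 0 < L) (hJ : J = I + 2 * A + L) :
    1 + 2 * (A : ℝ) / (L : ℝ) = ((J : ℝ) - I) / L := by
  have hL' : (L : ℝ) ≠ 0 := by exact_mod_cast hL.ne'
  rw [hJ]
  push_cast
  field_simp
  ring

theorem curve_le_optimum (hN : 2 ≤ N) (hK : 0 < K) (hAI : A ≤ I) (hL : 0 < L)
    (hJ : J = I + 2 * A + L) (hJH : J ≤ H) {M : ℝ} (h1 : 1 ≤ M) (hM : M ≤ N)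
    (hKM : K ≤ N ∨ (N < K ∧ 2 ≤ M)) :
    curveStorage N K L M ≤ 2 * (1 + 2 * (A : ℝ) / (L : ℝ)) * optStorage F N K H A I J M ∧
      curveLoad N K L M ≤ 12 * (1 + 2 * (A : ℝ) / (L : ℝ)) * optLoad F N K H A I J M := by
  have hIJ : I ≤ J := by omega
  have hL' : (0 : ℝ) < L := by exact_mod_cast hL
  have hK' : (0 : ℝ) < K := by exact_mod_cast hK
  have hN' : (2 : ℝ) ≤ N := by exact_mod_cast hN
  have hJI : (0 : ℝ) < (J : ℝ) - I := by
    rw [sub_pos]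
    exact_mod_cast (by omega : I < J)
  -- The curve itself shows that the sets under the infima are nonempty, which lower bounds for
  -- `sInf` over the reals require.
  have hmem : Achievable F N K H A I J M (curveStorage N K L M) (curveLoad N K L M) :=
    achievable_of_curve_le F hN hK hAI (by omega) hL h1 hM le_rfl le_rfl
  obtain ⟨t, θ, ht, h0, hθ, hMt, hτ⟩ := exists_segment hN hK h1 hM
  set f := segmentLoad K t θ with hf
  have hs : curveStorage N K L M = (N + f) / L := by
    rw [hMt, curveStorage_segment hN hK h0 hθ]
  have hl : curveLoad N K L M = f / L := by
    rw [hMt, curveLoad_segment hN hK h0 hθ]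
  have hf0 : 0 ≤ f := segmentLoad_nonneg ht h0 hθ
  rw [one_add_eq_div hL hJ]
  constructor
  · have hfN : f ≤ N := segmentLoad_le_of_le hN ht h0 hθ (hKM.imp id fun h => by
      rw [← hτ]
      nlinarith [h.2])
    -- The gap factor (J - I) / L is the ratio of the L in the scheme to the J - I servers that
    -- count in the converse.
    have hle : (N : ℝ) / (J - I) ≤ optStorage F N K H A I J M :=
      le_csInf ⟨_, _, hmem⟩ fun T hT => by
        obtain ⟨R, hR⟩ := hT
        rw [div_le_iff₀ hJI, mul_comm]
        exact hR.storage_lower_bound hIJ hJH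
    calc curveStorage N K L M ≤ 2 * N / L := by
          rw [hs]
          exact div_le_div_of_nonneg_right (by linarith) hL'.le
      _ = 2 * (((J : ℝ) - I) / L) * (N / (J - I)) := by field_simp
      _ ≤ _ := mul_le_mul_of_nonneg_left hle (by positivity)
  · have hf1 : f * (N - 1) ≤ K * (N - M) := by
      have := mul_le_mul_of_nonneg_right (segmentLoad_le_sub ht h0 hθ)
        (by linarith : (0 : ℝ) ≤ N - 1)
      linarith
    have hf2 : f * (M - 1) ≤ N - M := by
      have := mul_le_mul_of_nonneg_right (segmentLoad_mul_le (θ := θ) ht)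
        (by linarith : (0 : ℝ) ≤ N - 1)
      refine le_of_mul_le_mul_left ?_ hK'
      have e : f * ((K : ℝ) * (M - 1)) = f * (t + θ) * (N - 1) := by rw [hτ]; ring
      nlinarith
    obtain ⟨s, m, hsK, hm, hsm, hfs⟩ := exists_cutset hN hK h1 hM hf0 hf1 hf2
      (hKM.imp id And.right)
    have hle : f / (12 * (J - I)) ≤ optLoad F N K H A I J M :=
      le_csInf ⟨_, _, hmem⟩ fun R hR => by
        obtain ⟨T, hT⟩ := hR
        rw [div_le_iff₀ (by positivity)]
        linarith [hT.load_lower_bound hIJ hJH hsK hm hsm]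
    calc curveLoad N K L M = 12 * (((J : ℝ) - I) / L) * (f / (12 * (J - I))) := by
          rw [hl]
          field_simp
      _ ≤ _ := mul_le_mul_of_nonneg_left hle (by positivity)

end Main

end

end BlindServers

theorem theorem3 (F : Type u) [Field F] [Fintype F] (N K H A I J : ℕ)
    (hN : 2 ≤ N) (hK : 0 < K) (hA : 0 < A) (hAI : A ≤ I) (hIJ : I + 2 * A < J) (hJH : J ≤ H)
    (L : ℕ) (hL : L = BlindServers.numSubfiles A I J) :
    (∀ M T R : ℝ, 1 ≤ M → M ≤ N →
      BlindServers.curveStorage N K L M ≤ T → BlindServers.curveLoad N K L M ≤ R →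
      BlindServers.Achievable F N K H A I J M T R) ∧
    (∀ t : ℕ, t ≤ K →
      BlindServers.AchievableWithPackets F N K H A I J (L * K.choose t)
        (BlindServers.memPoint N K t) (BlindServers.storagePoint N K L t)
        (BlindServers.loadPoint K L t)) ∧
    (∀ M : ℝ, 1 ≤ M → M ≤ N → (K ≤ N ∨ (N < K ∧ 2 ≤ M)) →
      BlindServers.curveStorage N K L M ≤
          2 * (1 + 2 * (A : ℝ) / (L : ℝ)) * BlindServers.optStorage F N K H A I J M ∧
        BlindServers.curveLoad N K L M ≤
          12 * (1 + 2 * (A : ℝ) / (L : ℝ)) * BlindServers.optLoad F N K H A I J M) := by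
  have hL' : L = J - I - 2 * A := hL
  have hJ : J = I + 2 * A + L := by omega
  exact ⟨fun M T R h1 hM hT hR => BlindServers.achievable_of_curve_le F hN hK hAI (by omega)
      (by omega) h1 hM hT hR,
    fun t ht => BlindServers.achievableWithPackets_point F hN hK hAI (by omega) (by omega) ht,
    fun M h1 hM hKM => BlindServers.curve_le_optimum F hN hK hAI (by omega) hJ hJH h1 hM hKM⟩
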